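/- For a loopless matroid $M$ on a finite set $E$, let $P_M(t)\in\mathbb Z[t]$ denote its Kazhdan–Lusztig polynomial, i.e. the unique assignment such that $P_M=1$ if $\operatorname{rk}M=0$, $\deg P_M<\tfrac12\operatorname{rk}M$ if $\operatorname{rk}M>0$, and $$t^{\operatorname{rk}M}P_M(t^{-1})=\sum_{F}\chi_{M|F}(t)\,P_{M/F}(t),$$ where $F$ runs over the flats of $M$, $M|F$ and $M/F$ are the restriction to and the contraction by $F$, and $\chi_M(t)=\sum_{A\subseteq E}(-1)^{|A|}t^{\operatorname{rk}E-\operatorname{rk}A}$ is the characteristic polynomial. Let $a,b,n$ be positive integers. Let $C_n^{a,b}$ be the $(a,b)$-Catalan matroid: the matroid on $[n(a+b)]$ whose bases are the sets $T$ with $|T|=|S|$ whose $i$-th smallest element is at most the $i$-th smallest element of $S$ for all $i$, where $S\subseteq[n(a+b)]$ is the set with indicator vector $(0^a,1^b,0^a,1^b,\dots,0^a,1^b)$ ($n$ blocks $0^a,1^b$). For $m\ge1$ let $U_m^{a,b}$ be the uniform matroid of rank $mb$ on $m(a+b)$ elements. For a partition $\lambda=(\lambda_1,\dots,\lambda_k)\vdash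 n$ let $U_\lambda^{a,b}=U_{\lambda_1}^{a,b}\oplus\cdots\oplus U_{\lambda_k}^{a,b}$ and $z_\lambda=\prod_{i=1}^n i^{\alpha_i}\alpha_i!$, where $\alpha_i$ is the number of parts of $\lambda$ equal to $i$. **Corollary 4.4.** One has $$P_{C_n^{a,b}}(t)=\sum_{\lambda\vdash n}\frac1{z_\lambda}\,P_{U_\lambda^{a,b}}(t)\quad\text{in }\mathbb Q[t],\qquad\text{and}\qquad P_{U_\lambda^{a,b}}(t)=\prod_{i=1}^{k}P_{U_{\lambda_i}^{a,b}}(t)\ \text{ for every }\lambda=(\lambda_1,\dots,\lambda_k)\vdash n .$$ -/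

import Mathlib

open scoped Polynomial Nat

namespace CatalanKL

/-! ### Rank, characteristic polynomial and Kazhdan–Lusztig polynomial of a matroid -/

/-- The rank `rk_M(A)` of a set `A` in a matroid on a finite set, as a natural number. -/
noncomputable def rk {α : Type*} [Fintype α] (M : Matroid α) (A : Set α) : ℕ := (M.eRk A).toNat

open Classical in
/-- The characteristic polynomial
`χ_M(t) = ∑_{A ⊆ E} (-1)^|A| t^(rk E - rk A)`. -/
noncomputable def charPoly {α : Type*} [Fintype α] (M : Matroid α) : ℤ[X] :=
  ∑ A ∈ (Finset.univ : Finset (Finset α)).filter (fun A : Finset α => (A : Set α) ⊆ M.E),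
    (-1) ^ A.card * Polynomial.X ^ (rk M M.E - rk M (A : Set α))

open Classical in
/-- The Kazhdan–Lusztig polynomial of a loopless matroid `M` (Elias–Proudfoot–Wakefield).
It is the unique assignment of polynomials to loopless matroids such that

* `P_M = 1` if `rk M = 0`;
* `deg P_M < rk M / 2` if `rk M > 0`;
* `t^(rk M) P_M(1/t) = ∑_F χ_{M|F}(t) P_{M/F}(t)`, the sum being over all flats `F` of `M`.

Separating the term `F = ∅` from the others, the last condition reads
`t^(rk M) P_M(1/t) - P_M(t) = R(t)` with `R = ∑_{F ≠ ∅} χ_{M|F} P_{M/F}`. By the degree bound,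
`t^(rk M) P_M(1/t)` has only monomials of degree `> rk M / 2`, so for `i < rk M / 2` the
coefficient of `t^i` in `P_M` is minus the one in `R`. This is the recursion below.
(For matroids with loops the value is of no significance; if `M` is loopless, then so are all the
contractions `M / F` that occur.) -/
noncomputable def klPoly {α : Type*} [Fintype α] (M : Matroid α) : ℤ[X] :=
  if rk M M.E = 0 then 1
  else
    ∑ i ∈ Finset.range (rk M M.E) with 2 * i < rk M M.E,
      Polynomial.monomial i
        (-(∑ F : {F : Set α // M.IsFlat F ∧ F.Nonempty},
            charPoly (M.restrict F.1) * klPoly (M.contract F.1)).coeff i)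
termination_by M.E.ncard
decreasing_by
  obtain ⟨F, hF, hne⟩ := F
  rw [Matroid.contract_ground]
  refine Set.ncard_lt_ncard ?_ (Set.finite_univ.subset (Set.subset_univ _))
  refine ⟨Set.sdiff_subset, fun h => ?_⟩
  obtain ⟨x, hx⟩ := hne
  exact (h (hF.subset_ground hx)).2 hx

/-! ### Uniform matroids -/

/-- The uniform matroid `U_{k,N}` on an `N`-element set: its bases are the `k`-element subsets. -/
def uniformMatroid (k N : ℕ) (h : k ≤ N) : Matroid (Fin N) :=
  Matroid.ofIsBaseOfFinite (E := Set.univ) Set.finite_univ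
    (fun B => B.ncard = k)
    (by
      obtain ⟨B, -, hB⟩ := Set.exists_subset_card_eq (s := (Set.univ : Set (Fin N))) (n := k)
        (by simpa [Set.ncard_univ] using h)
      exact ⟨B, hB⟩)
    (by
      intro B₁ B₂ h₁ h₂ e he
      have hlt : ¬ B₂ ⊆ B₁ := fun hs => he.2 <| by
        rw [Set.eq_of_subset_of_ncard_le hs (by omega) (Set.toFinite _)]; exact he.1
      obtain ⟨f, hf₂, hf₁⟩ := Set.not_subset.1 hlt
      refine ⟨f, ⟨hf₂, hf₁⟩, ?_⟩
      change (insert f (B₁ \ {e})).ncard = k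
      rw [Set.ncard_insert_of_notMem (fun hc => hf₁ hc.1) (Set.toFinite _),
        Set.ncard_sdiff_singleton_add_one he.1 (Set.toFinite _)]
      exact h₁)
    (fun _ _ => Set.subset_univ _)

/-- `U_m^{a,b} = U_{mb, m(a+b)}`. -/
def uniformAB (a b m : ℕ) : Matroid (Fin (m * (a + b))) :=
  uniformMatroid (m * b) (m * (a + b)) (Nat.mul_le_mul_left m (Nat.le_add_left b a))

/-- `U_λ^{a,b}`: the direct sum of the matroids `U_{λ_i}^{a,b}` over the parts `λ_i` of `λ`
(with multiplicity). -/
def uniformSum (a b : ℕ) {n : ℕ} (l : n.Partition) :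
    Matroid ((i : l.parts.ToType) × Fin (i.1 * (a + b))) :=
  Matroid.sigma fun i : l.parts.ToType => uniformAB a b i.1

/-- `z_λ = ∏_{i=1}^n i^{α_i} α_i!`, where `α_i` is the number of parts of `λ` equal to `i`. -/
def zPart {n : ℕ} (l : n.Partition) : ℕ :=
  ∏ i ∈ Finset.Icc 1 n, i ^ l.parts.count i * (l.parts.count i)!

/-! ### Schubert matroids and Catalan matroids -/

/-- `T ≤ S`: the sets have the same size, and the `i`-th smallest element of `T` is at most the
`i`-th smallest element of `S`, for every `i`. -/
def SetLE {N : ℕ} (T S : Finset (Fin N)) : Prop :=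
  ∃ h : T.card = S.card, ∀ i : Fin S.card, T.orderEmbOfFin h i ≤ S.orderEmbOfFin rfl i

theorem card_filter_le_eq {N k : ℕ} (T : Finset (Fin N)) (h : T.card = k) (j : Fin N) :
    (T.filter (· ≤ j)).card
      = ((Finset.univ : Finset (Fin k)).filter (fun i => T.orderEmbOfFin h i ≤ j)).card := by
  rw [← Finset.card_map (T.orderEmbOfFin h).toEmbedding]
  congr 1
  ext x
  simp only [Finset.mem_filter, Finset.mem_map, Finset.mem_univ, true_and]
  constructor
  · rintro ⟨hx, hxj⟩
    have : x ∈ Set.range (T.orderEmbOfFin h) := by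
      rw [Finset.range_orderEmbOfFin]; exact hx
    obtain ⟨i, rfl⟩ := this
    exact ⟨i, hxj, rfl⟩
  · rintro ⟨i, hi, rfl⟩
    exact ⟨Finset.orderEmbOfFin_mem T h i, hi⟩

/-- `T ≤ S` in terms of the numbers of elements in initial intervals. -/
theorem setLE_iff {N : ℕ} (T S : Finset (Fin N)) :
    SetLE T S ↔ T.card = S.card ∧
      ∀ j : Fin N, (S.filter (· ≤ j)).card ≤ (T.filter (· ≤ j)).card := by
  constructor
  · rintro ⟨h, hle⟩
    refine ⟨h, fun j => ?_⟩
    rw [card_filter_le_eq S rfl j, card_filter_le_eq T h j]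
    refine Finset.card_le_card fun i hi => ?_
    simp only [Finset.mem_filter, Finset.mem_univ, true_and] at hi ⊢
    exact (hle i).trans hi
  · rintro ⟨h, hle⟩
    refine ⟨h, fun i => ?_⟩
    by_contra hlt
    push Not at hlt
    have h1 := hle (S.orderEmbOfFin rfl i)
    rw [card_filter_le_eq S rfl, card_filter_le_eq T h] at h1
    have h2 : (Finset.univ.filter
        (fun i' => S.orderEmbOfFin rfl i' ≤ S.orderEmbOfFin rfl i)) = Finset.Iic i := by
      ext x; simp
    have h3 : (Finset.univ.filter
        (fun i' => T.orderEmbOfFin h i' ≤ S.orderEmbOfFin rfl i)) ⊆ Finset.Iio i := by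
      intro x hx
      simp only [Finset.mem_filter, Finset.mem_univ, true_and, Finset.mem_Iio] at hx ⊢
      exact (T.orderEmbOfFin h).lt_iff_lt.1 (hx.trans_lt hlt)
    have h4 := h1.trans (Finset.card_le_card h3)
    rw [h2, Fin.card_Iic, Fin.card_Iio] at h4
    omega

theorem setLE_exchange {N : ℕ} (S : Finset (Fin N)) :
    Matroid.ExchangeProperty (fun B : Set (Fin N) => ∃ T : Finset (Fin N), (T : Set _) = B ∧
      SetLE T S) := by
  rintro _ _ ⟨T₁, rfl, h₁⟩ ⟨T₂, rfl, h₂⟩ e he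
  rw [setLE_iff] at h₁ h₂
  have he1 : e ∈ T₁ := he.1
  have he2 : e ∉ T₂ := he.2
  have hne : (T₂ \ T₁).Nonempty := by
    rw [Finset.sdiff_nonempty]
    intro hs
    rw [Finset.eq_of_subset_of_card_le hs (by omega)] at he2
    exact he2 he1
  set f := (T₂ \ T₁).min' hne with hf
  have hfm : f ∈ T₂ \ T₁ := Finset.min'_mem _ _
  have hfmin : ∀ x ∈ T₂ \ T₁, f ≤ x := fun x hx => Finset.min'_le _ x hx
  rw [Finset.mem_sdiff] at hfm
  have hfe : f ∉ T₁.erase e := fun hc => hfm.2 (Finset.mem_of_mem_erase hc)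
  refine ⟨f, ⟨hfm.1, hfm.2⟩, insert f (T₁.erase e), by simp, ?_⟩
  rw [setLE_iff]
  refine ⟨?_, fun j => ?_⟩
  · rw [Finset.card_insert_of_notMem hfe, Finset.card_erase_of_mem he1, ← h₁.1]
    have := Finset.card_pos.2 ⟨e, he1⟩
    omega
  · by_cases hej : e ≤ j
    · have hmem : e ∈ T₁.filter (· ≤ j) := by simp [he1, hej]
      by_cases hfj : f ≤ j
      · rw [Finset.filter_insert, if_pos hfj, Finset.filter_erase,
          Finset.card_insert_of_notMem
            (fun hc => hfm.2 (Finset.mem_filter.1 (Finset.mem_of_mem_erase hc)).1),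
          Finset.card_erase_of_mem hmem]
        have := h₁.2 j
        have := Finset.card_pos.2 ⟨e, hmem⟩
        omega
      · rw [Finset.filter_insert, if_neg hfj, Finset.filter_erase]
        refine (h₂.2 j).trans (Finset.card_le_card fun x hx => ?_)
        rw [Finset.mem_filter] at hx
        have hx1 : x ∈ T₁ := by
          by_contra hx1
          exact hfj ((hfmin x (Finset.mem_sdiff.2 ⟨hx.1, hx1⟩)).trans hx.2)
        rw [Finset.mem_erase, Finset.mem_filter]
        exact ⟨fun h => he2 (h ▸ hx.1), hx1, hx.2⟩
    · refine (h₁.2 j).trans (Finset.card_le_card fun x hx => ?_)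
      rw [Finset.mem_filter] at hx ⊢
      exact ⟨Finset.mem_insert_of_mem (Finset.mem_erase.2 ⟨fun h => hej (h ▸ hx.2), hx.1⟩), hx.2⟩

/-- The Schubert matroid of `S`: its bases are the sets `T ≤ S`. -/
def schubertMatroid {N : ℕ} (S : Finset (Fin N)) : Matroid (Fin N) :=
  Matroid.ofIsBaseOfFinite (E := Set.univ) Set.finite_univ
    (fun B => ∃ T : Finset (Fin N), (T : Set _) = B ∧ SetLE T S)
    ⟨S, S, rfl, rfl, fun _ => le_rfl⟩
    (setLE_exchange S)
    (fun _ _ => Set.subset_univ _)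

/-- The set with indicator vector `(0^a, 1^b, 0^a, 1^b, …, 0^a, 1^b)`, where `n` blocks `0^a, 1^b`
occur (positions are numbered from `0`). -/
def catalanSet (a b n : ℕ) : Finset (Fin (n * (a + b))) :=
  Finset.univ.filter fun x => a ≤ (x : ℕ) % (a + b)

/-- The `(a,b)`-Catalan matroid `C_n^{a,b}`. -/
def catalanMatroid (a b n : ℕ) : Matroid (Fin (n * (a + b))) :=
  schubertMatroid (catalanSet a b n)

end CatalanKL

/-! A matroid is encoded by its nullity function `S ↦ |S| - rk S`. Cut the ground set into `n`
blocks of size `a + b` and let `x i` be the excess `S ↦ |S ∩ block i| - b`. The uniform matroid of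
rank `|J| * b` on the blocks in `J` has nullity `(∑ i ∈ J, x i)⁺`, and nullities add in direct sums.
The Catalan matroid has nullity `(x iₙ + (x iₙ₋₁ + ⋯)⁺)⁺`, the maximum over `k` of `|S ∩ last k
blocks| - k * b`; any other order of the blocks gives an isomorphic matroid.

In the algebra of formal combinations of functions, where multiplication adds exponents and `P` is
the positive part, the corollary takes the shape of Spitzer's identity: the sum over all orderings
of the nested expressions `P (x i₁ * P (x i₂ * ⋯))` equals the sum over all permutations of the
products, over the cycles `J`, of `P (∏ i ∈ J, x i)`. Sorting permutations by cycle type and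
dividing by `n!` produces the weights `1 / z_λ`.

Spitzer's identity needs the Rota–Baxter relation `P u * P v = P (P u * v + u * P v - u * v)`. It
holds for monotone functions on a chain (`posMap_rotaBaxter`), which is not enough for functions on
all subsets. However, unrolling the recursion writes the Kazhdan–Lusztig polynomial as a combination
of terms that each see the rank function on a single chain of sets (`setKL_mem_chainSpan`). So the
Kazhdan–Lusztig functional takes equal values on the two sides (`linExt_orderSum_eq`), and it
remains to compute these values: `n!` times the Catalan polynomial on one side, `n!` times the
weighted sum over partitions on the other (`linExt_cycleSum`).

To make the recursion uniform, the polynomials are defined for set functions on intervals of the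
whole Boolean lattice; sets that are not flats contribute zero. Multiplicativity on direct sums
follows from the uniqueness of the solution of the functional equation. -/

namespace CatalanKL

open Finset

/-! ### Kazhdan–Lusztig polynomials of set functions on Boolean intervals -/

section SetKL

variable {α : Type*} [DecidableEq α]

/-- The part of a polynomial of degree less than `r / 2`. -/
noncomputable def lowPart (r : ℕ) : ℤ[X] →ₗ[ℤ] ℤ[X] where
  toFun f := ∑ i ∈ range r with 2 * i < r, Polynomial.monomial i (f.coeff i)
  map_add' f g := by simp [sum_add_distrib]
  map_smul' c f := by simp [smul_sum, Polynomial.smul_monomial]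

theorem coeff_lowPart (r : ℕ) (f : ℤ[X]) (i : ℕ) :
    (lowPart r f).coeff i = if 2 * i < r then f.coeff i else 0 := by
  simp only [lowPart, LinearMap.coe_mk, AddHom.coe_mk, Polynomial.finsetSum_coeff,
    Polynomial.coeff_monomial, sum_ite_eq', mem_filter, mem_range]
  congr 1
  simp only [eq_iff_iff]
  omega

/-- The characteristic polynomial of a set function on the interval `[A, B]`. -/
noncomputable def setChi (ρ : Finset α → ℕ) (A B : Finset α) : ℤ[X] :=
  ∑ S ∈ Icc A B, (-1) ^ (S \ A).card * Polynomial.X ^ (ρ B - ρ S)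

/-- The Kazhdan–Lusztig polynomial of a set function on the interval `[A, B]`. -/
noncomputable def setKL (ρ : Finset α → ℕ) (A B : Finset α) : ℤ[X] :=
  -- The normalisation is at `A = B`, not at rank zero. Hence the value is `0` whenever the interval
  -- contains a loop, which is what allows a sum over all sets instead of flats.
  if A = B then 1
  else -lowPart (ρ B - ρ A) (∑ F : {F // F ∈ Ioc A B}, setChi ρ A F.1 * setKL ρ F.1 B)
termination_by (B \ A).card
decreasing_by
  obtain ⟨F, hF⟩ := F
  rw [mem_Ioc] at hF
  have hs := Finset.ssubset_iff_subset_ne.1 hF.1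
  obtain ⟨x, hxF, hxA⟩ := Finset.exists_of_ssubset hF.1
  refine card_lt_card (Finset.ssubset_iff_subset_ne.2 ⟨sdiff_subset_sdiff Subset.rfl hs.1, ?_⟩)
  intro h
  have hx : x ∈ B \ A := mem_sdiff.2 ⟨hF.2 hxF, hxA⟩
  rw [← h] at hx
  exact (mem_sdiff.1 hx).2 hxF

theorem setKL_self (ρ : Finset α → ℕ) (A : Finset α) : setKL ρ A A = 1 := by
  rw [setKL, if_pos rfl]

theorem setKL_of_ne (ρ : Finset α → ℕ) {A B : Finset α} (h : A ≠ B) :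
    setKL ρ A B = -lowPart (ρ B - ρ A) (∑ F ∈ Ioc A B, setChi ρ A F * setKL ρ F B) := by
  rw [setKL, if_neg h, ← Finset.sum_coe_sort (Ioc A B)]

theorem card_sdiff_lt_card_sdiff {A F B : Finset α} (hF : F ∈ Ioc A B) :
    (B \ F).card < (B \ A).card := by
  rw [mem_Ioc] at hF
  have h1 := card_lt_card hF.1
  have h2 := card_sdiff_of_subset hF.2
  have h3 := card_sdiff_of_subset (hF.1.le.trans hF.2)
  have h4 := card_le_card hF.2
  omega

/-- Induction on intervals of finite sets with fixed upper end. -/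
theorem interval_induction {B : Finset α} {p : Finset α → Prop}
    (h : ∀ A, (∀ F ∈ Ioc A B, p F) → p A) (A : Finset α) : p A := by
  induction hn : (B \ A).card using Nat.strong_induction_on generalizing A with
  | _ n ih =>
    subst hn
    exact h A fun F hF => ih _ (card_sdiff_lt_card_sdiff hF) F rfl

theorem setChi_self (ρ : Finset α → ℕ) (A : Finset α) : setChi ρ A A = 1 := by
  simp [setChi]

theorem setKL_coeff_eq_zero (ρ : Finset α → ℕ) {A B : Finset α} (h : A ≠ B) {i : ℕ}
    (hi : ρ B - ρ A ≤ 2 * i) : (setKL ρ A B).coeff i = 0 := by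
  rw [setKL_of_ne ρ h, Polynomial.coeff_neg, coeff_lowPart, if_neg (by omega), neg_zero]

theorem sum_Ioc_eq_sum_Icc_sub {M : Type*} [AddCommGroup M] (f : Finset α → M) {A B : Finset α}
    (h : A ⊆ B) : ∑ F ∈ Ioc A B, f F = ∑ F ∈ Icc A B, f F - f A := by
  rw [← Finset.add_sum_Ioc_eq_sum_Icc (f := f) h]; abel

theorem sum_Icc_neg_one_pow (A B : Finset α) (h : A ⊆ B) :
    ∑ S ∈ Icc A B, (-1 : ℤ[X]) ^ (S \ A).card = if A = B then 1 else 0 := by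
  rw [Icc_eq_image_powerset h, sum_image]
  · have : ∀ S ∈ (B \ A).powerset, (-1 : ℤ[X]) ^ ((A ∪ S) \ A).card = (-1) ^ S.card := by
      intro S hS
      rw [union_sdiff_cancel_left]
      exact (disjoint_sdiff.mono_right (mem_powerset.1 hS))
    rw [sum_congr rfl this]
    have h2 := congrArg (Int.castRingHom ℤ[X]) (sum_powerset_neg_one_pow_card (x := B \ A))
    simp only [map_sum, map_pow, map_neg, map_one] at h2
    rw [h2, apply_ite (Int.castRingHom ℤ[X])]
    simp only [map_one, map_zero, sdiff_eq_empty_iff_subset]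
    congr 1
    exact propext ⟨fun h' => h.antisymm h', fun h' => h'.ge⟩
  · intro S hS T hT hST
    have hS' := disjoint_sdiff.mono_right (mem_powerset.1 hS)
    have hT' := disjoint_sdiff.mono_right (mem_powerset.1 hT)
    have := congrArg (· \ A) hST
    simpa only [union_sdiff_cancel_left hS', union_sdiff_cancel_left hT'] using this

theorem sum_Icc_neg_one_pow' (A B : Finset α) (h : A ⊆ B) :
    ∑ S ∈ Icc A B, (-1 : ℤ[X]) ^ (B \ S).card = if A = B then 1 else 0 := by
  have key : ∀ S ∈ Icc A B, (-1 : ℤ[X]) ^ (B \ S).card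
      = (-1) ^ (B \ A).card * (-1) ^ (S \ A).card := by
    intro S hS
    rw [mem_Icc] at hS
    have h1 := card_sdiff_of_subset hS.1
    have h2 := card_sdiff_of_subset hS.2
    have h3 := card_sdiff_of_subset h
    have h4 := card_le_card hS.1
    have h5 := card_le_card hS.2
    have : (B \ A).card = (B \ S).card + (S \ A).card := by omega
    rw [this, pow_add, mul_assoc, ← pow_add, ← two_mul, pow_mul]
    simp
  rw [sum_congr rfl key, ← mul_sum, sum_Icc_neg_one_pow A B h]
  split_ifs with h'
  · simp [h']
  · simp

/-- The characteristic polynomial with its coefficients reversed. -/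
noncomputable def setChiRev (ρ : Finset α → ℕ) (A B : Finset α) : ℤ[X] :=
  ∑ S ∈ Icc A B, (-1) ^ (S \ A).card * Polynomial.X ^ (ρ S - ρ A)

theorem natDegree_setChi_le {ρ : Finset α → ℕ} (hρ : Monotone ρ) (A B : Finset α) :
    (setChi ρ A B).natDegree ≤ ρ B - ρ A := by
  refine Polynomial.natDegree_sum_le_of_forall_le _ _ fun S hS => ?_
  rw [mem_Icc] at hS
  have h1 := hρ hS.1
  refine (Polynomial.natDegree_mul_le).trans ?_
  have h2 : ((-1 : ℤ[X]) ^ (S \ A).card).natDegree = 0 := by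
    rcases neg_one_pow_eq_or ℤ[X] (S \ A).card with h | h <;> simp [h]
  rw [h2, Polynomial.natDegree_X_pow]
  omega

theorem natDegree_setKL_le (ρ : Finset α → ℕ) (A B : Finset α) :
    (setKL ρ A B).natDegree ≤ ρ B - ρ A := by
  by_cases h : A = B
  · subst h; simp [setKL_self]
  · rw [Polynomial.natDegree_le_iff_coeff_eq_zero]
    intro i hi
    exact setKL_coeff_eq_zero ρ h (by omega)

theorem reflect_sum {ι : Type*} (s : Finset ι) (f : ι → ℤ[X]) (N : ℕ) :
    Polynomial.reflect N (∑ i ∈ s, f i) = ∑ i ∈ s, Polynomial.reflect N (f i) := by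
  ext j
  simp [Polynomial.coeff_reflect]

theorem reflect_neg_one_pow_mul_X_pow (k : ℕ) {N m : ℕ} (h : m ≤ N) :
    Polynomial.reflect N ((-1 : ℤ[X]) ^ k * Polynomial.X ^ m)
      = (-1) ^ k * Polynomial.X ^ (N - m) := by
  have : (-1 : ℤ[X]) ^ k = Polynomial.C ((-1) ^ k) := by simp
  rw [this, Polynomial.reflect_C_mul_X_pow, Polynomial.revAt_le h]

theorem reflect_setChi {ρ : Finset α → ℕ} (hρ : Monotone ρ) (A B : Finset α) :
    Polynomial.reflect (ρ B - ρ A) (setChi ρ A B) = setChiRev ρ A B := by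
  rw [setChi, setChiRev, reflect_sum]
  refine sum_congr rfl fun S hS => ?_
  rw [mem_Icc] at hS
  have h1 := hρ hS.1
  have h2 := hρ hS.2
  rw [reflect_neg_one_pow_mul_X_pow _ (by omega)]
  congr 2
  omega

theorem sum_Icc_sum_Icc_comm {M : Type*} [AddCommMonoid M] (A B : Finset α)
    (f : Finset α → Finset α → M) :
    ∑ F ∈ Icc A B, ∑ G ∈ Icc F B, f F G = ∑ G ∈ Icc A B, ∑ F ∈ Icc A G, f F G := by
  refine sum_comm' fun F G => ?_
  simp only [mem_Icc]
  constructor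
  · rintro ⟨⟨h1, h2⟩, h3, h4⟩; exact ⟨⟨h1, h3⟩, h1.trans h3, h4⟩
  · rintro ⟨⟨h1, h2⟩, h3, h4⟩; exact ⟨⟨h1, h2.trans h4⟩, h2, h4⟩

/-- Expanding both factors gives a sum over `S ⊆ F ⊆ T`. The alternating sum over `F` leaves only `S
= T`; then the exponents add up to `ρ B - ρ A`, independently of `S`, and the alternating sum over
`S` finishes. -/
theorem sum_setChiRev_mul_setChi {ρ : Finset α → ℕ} (hρ : Monotone ρ) {A B : Finset α}
    (h : A ⊆ B) :
    ∑ F ∈ Icc A B, setChiRev ρ A F * setChi ρ F B = if A = B then 1 else 0 := by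
  have step : ∀ F ∈ Icc A B, setChiRev ρ A F * setChi ρ F B
      = ∑ S ∈ Icc A F, ∑ T ∈ Icc F B, (-1) ^ (S \ A).card * Polynomial.X ^ (ρ S - ρ A) *
        ((-1) ^ (T \ F).card * Polynomial.X ^ (ρ B - ρ T)) := by
    intro F _
    rw [setChiRev, setChi, sum_mul_sum]
  rw [sum_congr rfl step, ← sum_Icc_sum_Icc_comm]
  have step2 : ∀ S ∈ Icc A B, ∑ F ∈ Icc S B, ∑ T ∈ Icc F B,
      ((-1) ^ (S \ A).card * Polynomial.X ^ (ρ S - ρ A) *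
        ((-1) ^ (T \ F).card * Polynomial.X ^ (ρ B - ρ T)) : ℤ[X])
      = Polynomial.X ^ (ρ B - ρ A) * (-1) ^ (S \ A).card := by
    intro S hS
    rw [mem_Icc] at hS
    rw [sum_Icc_sum_Icc_comm]
    have : ∀ T ∈ Icc S B, ∑ F ∈ Icc S T,
      ((-1) ^ (S \ A).card * Polynomial.X ^ (ρ S - ρ A) *
        ((-1) ^ (T \ F).card * Polynomial.X ^ (ρ B - ρ T)) : ℤ[X])
        = if T = S then (-1) ^ (S \ A).card * Polynomial.X ^ (ρ S - ρ A) *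
          Polynomial.X ^ (ρ B - ρ T) else 0 := by
      intro T hT
      rw [mem_Icc] at hT
      rw [← mul_sum, ← sum_mul, sum_Icc_neg_one_pow' S T hT.1]
      by_cases hST : S = T
      · simp [hST]
      · simp [hST, Ne.symm hST]
    rw [sum_congr rfl this, sum_ite_eq', if_pos (mem_Icc.2 ⟨le_rfl, hS.2⟩), mul_assoc, ← pow_add,
      mul_comm]
    congr 2
    have := hρ hS.1
    have := hρ hS.2
    omega
  rw [sum_congr rfl step2, ← mul_sum, sum_Icc_neg_one_pow A B h]
  split_ifs with h'
  · simp [h']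
  · simp

/-- The defining functional equation of Kazhdan–Lusztig polynomials. -/
theorem reflect_setKL {ρ : Finset α → ℕ} (hρ : Monotone ρ) {A B : Finset α} (h : A ⊆ B) :
    Polynomial.reflect (ρ B - ρ A) (setKL ρ A B)
      = ∑ F ∈ Icc A B, setChi ρ A F * setKL ρ F B := by
  revert h
  refine interval_induction (B := B) (p := fun A => A ⊆ B →
    Polynomial.reflect (ρ B - ρ A) (setKL ρ A B)
      = ∑ F ∈ Icc A B, setChi ρ A F * setKL ρ F B) (fun A ih hAB => ?_) A
  by_cases hne : A = B
  · subst hne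
    simp [setKL_self, setChi_self]
  set R := ∑ F ∈ Ioc A B, setChi ρ A F * setKL ρ F B with hR
  have hsum : ∑ F ∈ Icc A B, setChi ρ A F * setKL ρ F B = setKL ρ A B + R := by
    rw [hR, sum_Ioc_eq_sum_Icc_sub _ hAB, setChi_self]; ring
  -- The heart of the matter is that `R` is antisymmetric under reversal. By induction its reversal
  -- is a double sum of `setChiRev * setChi * setKL`; with the term `F = A` included, inversion
  -- collapses that sum to `setKL ρ A B`, and the term `F = A` is `setKL ρ A B + R`.
  have hrev : Polynomial.reflect (ρ B - ρ A) R = -R := by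
    have h1 : Polynomial.reflect (ρ B - ρ A) R = ∑ F ∈ Ioc A B, setChiRev ρ A F *
        ∑ G ∈ Icc F B, setChi ρ F G * setKL ρ G B := by
      rw [hR, reflect_sum]
      refine sum_congr rfl fun F hF => ?_
      have hF' := mem_Ioc.1 hF
      have m1 := hρ hF'.1.le
      have m2 := hρ hF'.2
      rw [show ρ B - ρ A = (ρ F - ρ A) + (ρ B - ρ F) by omega,
        Polynomial.reflect_mul _ _ (natDegree_setChi_le hρ A F) (natDegree_setKL_le ρ F B),
        reflect_setChi hρ, ih F hF hF'.2]
    rw [h1, sum_Ioc_eq_sum_Icc_sub _ hAB]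
    have h2 : ∑ F ∈ Icc A B, setChiRev ρ A F * ∑ G ∈ Icc F B, setChi ρ F G * setKL ρ G B
        = setKL ρ A B := by
      simp only [mul_sum]
      rw [sum_Icc_sum_Icc_comm]
      have : ∀ G ∈ Icc A B, ∑ F ∈ Icc A G, setChiRev ρ A F * (setChi ρ F G * setKL ρ G B)
          = if A = G then setKL ρ G B else 0 := by
        intro G hG
        simp only [← mul_assoc]
        rw [← sum_mul, sum_setChiRev_mul_setChi hρ (mem_Icc.1 hG).1]
        split_ifs <;> simp
      rw [sum_congr rfl this, sum_ite_eq, if_pos (mem_Icc.2 ⟨le_rfl, hAB⟩)]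
    rw [h2, hsum]
    simp [setChiRev]
  rw [hsum]
  set r := ρ B - ρ A with hr
  have hK : setKL ρ A B = -lowPart r R := setKL_of_ne ρ hne
  ext i
  have hci := congrArg (fun p => Polynomial.coeff p i) hrev
  simp only [Polynomial.coeff_reflect, Polynomial.coeff_neg] at hci
  rw [Polynomial.coeff_reflect, Polynomial.coeff_add, hK, Polynomial.coeff_neg,
    Polynomial.coeff_neg, coeff_lowPart, coeff_lowPart]
  by_cases hir : i ≤ r
  · rw [Polynomial.revAt_le hir] at hci ⊢
    by_cases h1 : 2 * i < r
    · rw [if_neg (by omega), if_pos h1]; ring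
    · rw [if_neg h1]
      by_cases h2 : 2 * (r - i) < r
      · rw [if_pos h2, hci]; ring
      · rw [if_neg h2]
        -- Only the middle degree `2 * i = r` is left, where antisymmetry forces the coefficient of
        -- `R` to vanish.
        have : r - i = i := by omega
        rw [this] at hci
        omega
  · rw [Polynomial.revAt_eq_self_of_lt (by omega)] at hci ⊢
    rw [if_neg (by omega)]
    omega

/-- Kazhdan–Lusztig polynomials are determined by the degree bound and the functional equation. -/
theorem eq_setKL_of_reflect {ρ : Finset α → ℕ} {B : Finset α} (Q : Finset α → ℤ[X])
    (hB : Q B = 1)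
    (hdeg : ∀ A ⊆ B, A ≠ B → ∀ i, ρ B - ρ A ≤ 2 * i → (Q A).coeff i = 0)
    (heq : ∀ A ⊆ B, Polynomial.reflect (ρ B - ρ A) (Q A) = ∑ F ∈ Icc A B, setChi ρ A F * Q F)
    {A : Finset α} (h : A ⊆ B) : Q A = setKL ρ A B := by
  revert h
  refine interval_induction (B := B) (p := fun A => A ⊆ B → Q A = setKL ρ A B)
    (fun A ih hAB => ?_) A
  by_cases hne : A = B
  · subst hne; rw [hB, setKL_self]
  rw [setKL_of_ne ρ hne]
  -- By induction the recursion may be read with `Q`, so its sum is the reversal of `Q A` minus `Q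
  -- A`. The degree bound puts the reversal in degrees above half the rank, so `lowPart` only sees
  -- `-Q A`.
  have h1 : ∑ F ∈ Ioc A B, setChi ρ A F * setKL ρ F B
      = Polynomial.reflect (ρ B - ρ A) (Q A) - Q A := by
    have h2 : ∑ F ∈ Ioc A B, setChi ρ A F * setKL ρ F B = ∑ F ∈ Ioc A B, setChi ρ A F * Q F :=
      sum_congr rfl fun F hF => by rw [ih F hF (mem_Ioc.1 hF).2]
    rw [heq A hAB, h2, sum_Ioc_eq_sum_Icc_sub _ hAB, setChi_self, one_mul]
  rw [h1]
  ext i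
  rw [Polynomial.coeff_neg, coeff_lowPart, Polynomial.coeff_sub, Polynomial.coeff_reflect]
  split_ifs with hi
  · rw [Polynomial.revAt_le (by omega), hdeg A hAB hne (ρ B - ρ A - i) (by omega)]
    ring
  · rw [hdeg A hAB hne i (by omega), neg_zero]

theorem setChi_congr {ρ ρ' : Finset α → ℕ} {A B : Finset α}
    (h : ∀ S ∈ Icc A B, ρ S = ρ' S) : setChi ρ A B = setChi ρ' A B := by
  by_cases hAB : A ⊆ B
  · refine sum_congr rfl fun S hS => ?_
    rw [h S hS, h B (mem_Icc.2 ⟨hAB, le_rfl⟩)]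
  · rw [setChi, setChi, Icc_eq_empty hAB, sum_empty, sum_empty]

theorem setKL_congr {ρ ρ' : Finset α → ℕ} {A B : Finset α}
    (h : ∀ S ∈ Icc A B, ρ S = ρ' S) : setKL ρ A B = setKL ρ' A B := by
  revert h
  refine interval_induction (B := B) (p := fun A => (∀ S ∈ Icc A B, ρ S = ρ' S) →
    setKL ρ A B = setKL ρ' A B) (fun A ih h => ?_) A
  by_cases hne : A = B
  · subst hne; rw [setKL_self, setKL_self]
  rw [setKL_of_ne _ hne, setKL_of_ne _ hne]
  by_cases hAB : A ⊆ B
  · rw [h A (mem_Icc.2 ⟨le_rfl, hAB⟩), h B (mem_Icc.2 ⟨hAB, le_rfl⟩)]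
    refine congrArg (fun p => -lowPart _ p) (sum_congr rfl fun F hF => ?_)
    have hF' := mem_Ioc.1 hF
    rw [ih F hF fun S hS => h S (mem_Icc.2 ⟨hF'.1.le.trans (mem_Icc.1 hS).1, (mem_Icc.1 hS).2⟩),
      setChi_congr fun S hS => h S (mem_Icc.2 ⟨(mem_Icc.1 hS).1, (mem_Icc.1 hS).2.trans hF'.2⟩)]
  · rw [Ioc_eq_empty fun h' => hAB h'.le, sum_empty, sum_empty, map_zero, map_zero]

theorem image_map_Icc {β : Type*} [DecidableEq β] (e : α ↪ β) (A B : Finset α) :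
    Icc (A.map e) (B.map e) = (Icc A B).map (mapEmbedding e).toEmbedding := by
  ext S
  simp only [mem_Icc, mem_map]
  constructor
  · rintro ⟨h1, h2⟩
    obtain ⟨T, hT, rfl⟩ := subset_map_iff.1 h2
    exact ⟨T, ⟨map_subset_map.1 h1, hT⟩, rfl⟩
  · rintro ⟨T, ⟨h1, h2⟩, rfl⟩
    exact ⟨map_subset_map.2 h1, map_subset_map.2 h2⟩

theorem image_map_Ioc {β : Type*} [DecidableEq β] (e : α ↪ β) (A B : Finset α) :
    Ioc (A.map e) (B.map e) = (Ioc A B).map (mapEmbedding e).toEmbedding := by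
  ext S
  simp only [mem_Ioc, mem_map]
  constructor
  · rintro ⟨h1, h2⟩
    obtain ⟨T, hT, rfl⟩ := subset_map_iff.1 h2
    exact ⟨T, ⟨map_ssubset_map.1 h1, hT⟩, rfl⟩
  · rintro ⟨T, ⟨h1, h2⟩, rfl⟩
    exact ⟨map_ssubset_map.2 h1, map_subset_map.2 h2⟩

theorem setChi_map {β : Type*} [DecidableEq β] (e : α ↪ β) (ρ : Finset β → ℕ) (A B : Finset α) :
    setChi ρ (A.map e) (B.map e) = setChi (fun S => ρ (S.map e)) A B := by
  rw [setChi, setChi, image_map_Icc, sum_map]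
  refine sum_congr rfl fun S _ => ?_
  simp only [RelEmbedding.coe_toEmbedding, mapEmbedding_apply]
  rw [← Finset.map_sdiff, card_map]

theorem setKL_map {β : Type*} [DecidableEq β] (e : α ↪ β) (ρ : Finset β → ℕ) (A B : Finset α) :
    setKL ρ (A.map e) (B.map e) = setKL (fun S => ρ (S.map e)) A B := by
  refine interval_induction (B := B) (p := fun A =>
    setKL ρ (A.map e) (B.map e) = setKL (fun S => ρ (S.map e)) A B) (fun A ih => ?_) A
  by_cases hne : A = B
  · subst hne; rw [setKL_self, setKL_self]
  rw [setKL_of_ne _ hne, setKL_of_ne _ (fun h => hne (map_injective e h)), image_map_Ioc, sum_map]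
  refine congrArg (fun p => -lowPart _ p) (sum_congr rfl fun F hF => ?_)
  simp only [RelEmbedding.coe_toEmbedding, mapEmbedding_apply]
  rw [ih F hF, setChi_map]

end SetKL

/-! ### Direct sums and loops -/

section DirectSum

variable {α : Type*} [DecidableEq α]

theorem sum_Icc_split {E₁ E₂ A F : Finset α} (hd : Disjoint E₁ E₂)
    (hAF : A ⊆ F) (hF : F ⊆ E₁ ∪ E₂) (g h : Finset α → ℤ[X]) :
    ∑ S ∈ Icc A F, g (S ∩ E₁) * h (S ∩ E₂)
      = (∑ S ∈ Icc (A ∩ E₁) (F ∩ E₁), g S) * ∑ S ∈ Icc (A ∩ E₂) (F ∩ E₂), h S := by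
  rw [sum_mul_sum, ← sum_product']
  have hcap : ∀ S T : Finset α, S ⊆ E₁ → T ⊆ E₂ → (S ∪ T) ∩ E₁ = S ∧ (S ∪ T) ∩ E₂ = T := by
    intro S T hS hT
    rw [disjoint_left] at hd
    constructor <;> ext x <;> simp only [mem_inter, mem_union]
    · exact ⟨fun ⟨h1, h2⟩ => h1.resolve_right fun h3 => hd h2 (hT h3), fun h1 => ⟨.inl h1, hS h1⟩⟩
    · exact ⟨fun ⟨h1, h2⟩ => h1.resolve_left fun h3 => hd (hS h3) h2, fun h1 => ⟨.inr h1, hT h1⟩⟩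
  have hun : ∀ S ⊆ E₁ ∪ E₂, S ∩ E₁ ∪ S ∩ E₂ = S := by
    intro S hS
    rw [← inter_union_distrib_left, inter_eq_left.2 hS]
  refine sum_bij' (fun S _ => (S ∩ E₁, S ∩ E₂)) (fun p _ => p.1 ∪ p.2) ?_ ?_ ?_ ?_ ?_
  · intro S hS
    rw [mem_Icc] at hS
    simp only [mem_product, mem_Icc]
    exact ⟨⟨inter_subset_inter_right hS.1, inter_subset_inter_right hS.2⟩,
      inter_subset_inter_right hS.1, inter_subset_inter_right hS.2⟩
  · rintro ⟨S, T⟩ hp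
    simp only [mem_product, mem_Icc] at hp ⊢
    constructor
    · rw [← hun A (hAF.trans hF)]
      exact union_subset_union hp.1.1 hp.2.1
    · exact union_subset (hp.1.2.trans inter_subset_left) (hp.2.2.trans inter_subset_left)
  · intro S hS
    exact hun S ((mem_Icc.1 hS).2.trans hF)
  · rintro ⟨S, T⟩ hp
    simp only [mem_product, mem_Icc] at hp
    obtain ⟨h1, h2⟩ := hcap S T (hp.1.2.trans inter_subset_right) (hp.2.2.trans inter_subset_right)
    simp [h1, h2]
  · intro S _; rfl

theorem setChi_mul {ρ : Finset α → ℕ} (hρ : Monotone ρ) {E₁ E₂ : Finset α} (hd : Disjoint E₁ E₂)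
    (hadd : ∀ S ⊆ E₁ ∪ E₂, ρ S = ρ (S ∩ E₁) + ρ (S ∩ E₂)) {A F : Finset α} (hAF : A ⊆ F)
    (hF : F ⊆ E₁ ∪ E₂) :
    setChi ρ A F = setChi ρ (A ∩ E₁) (F ∩ E₁) * setChi ρ (A ∩ E₂) (F ∩ E₂) := by
  rw [setChi, setChi, setChi, ← sum_Icc_split hd hAF hF]
  refine sum_congr rfl fun S hS => ?_
  rw [mem_Icc] at hS
  have hSF := hS.2.trans hF
  have hcard : (S \ A).card = ((S ∩ E₁) \ (A ∩ E₁)).card + ((S ∩ E₂) \ (A ∩ E₂)).card := by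
    have he : ∀ E : Finset α, (S ∩ E) \ (A ∩ E) = (S \ A) ∩ E := by
      intro E; ext x; simp only [mem_sdiff, mem_inter]; tauto
    rw [he, he, ← card_union_of_disjoint,
      ← inter_union_distrib_left, inter_eq_left.2 (sdiff_subset.trans hSF)]
    exact hd.mono inter_subset_right inter_subset_right
  have h1 := hρ (inter_subset_inter_right (u := E₁) hS.2)
  have h2 := hρ (inter_subset_inter_right (u := E₂) hS.2)
  have hexp : ρ F - ρ S = (ρ (F ∩ E₁) - ρ (S ∩ E₁)) + (ρ (F ∩ E₂) - ρ (S ∩ E₂)) := by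
    rw [hadd F hF, hadd S hSF]
    omega
  rw [hcard, hexp, pow_add, pow_add]
  ring

/-- Kazhdan–Lusztig polynomials are multiplicative on direct sums. -/
theorem setKL_union {ρ : Finset α → ℕ} (hρ : Monotone ρ) {E₁ E₂ : Finset α} (hd : Disjoint E₁ E₂)
    (hadd : ∀ S ⊆ E₁ ∪ E₂, ρ S = ρ (S ∩ E₁) + ρ (S ∩ E₂)) {A : Finset α} (hA : A ⊆ E₁ ∪ E₂) :
    setKL ρ A (E₁ ∪ E₂) = setKL ρ (A ∩ E₁) E₁ * setKL ρ (A ∩ E₂) E₂ := by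
  have hE₁ : (E₁ ∪ E₂) ∩ E₁ = E₁ := inter_eq_right.2 subset_union_left
  have hE₂ : (E₁ ∪ E₂) ∩ E₂ = E₂ := inter_eq_right.2 subset_union_right
  have hr : ∀ A ⊆ E₁ ∪ E₂, ρ (E₁ ∪ E₂) - ρ A = (ρ E₁ - ρ (A ∩ E₁)) + (ρ E₂ - ρ (A ∩ E₂)) := by
    intro A hA
    rw [hadd _ Subset.rfl, hadd A hA, hE₁, hE₂]
    have h1 := hρ (inter_subset_right (s₁ := A) (s₂ := E₁))
    have h2 := hρ (inter_subset_right (s₁ := A) (s₂ := E₂))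
    omega
  -- By uniqueness it suffices that the product satisfies the degree bound and the functional
  -- equation.
  refine (eq_setKL_of_reflect (ρ := ρ) (fun A => setKL ρ (A ∩ E₁) E₁ * setKL ρ (A ∩ E₂) E₂)
    ?_ ?_ ?_ hA).symm
  · simp only [hE₁, hE₂, setKL_self, one_mul]
  · intro A hA hne i hi
    rw [hr A hA] at hi
    by_cases h1 : A ∩ E₁ = E₁
    · by_cases h2 : A ∩ E₂ = E₂
      · exact (hne (hA.antisymm (union_subset (inter_eq_right.1 h1) (inter_eq_right.1 h2)))).elim
      · simp only [h1, setKL_self, one_mul]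
        exact setKL_coeff_eq_zero ρ h2 (by omega)
    · by_cases h2 : A ∩ E₂ = E₂
      · simp only [h2, setKL_self, mul_one]
        exact setKL_coeff_eq_zero ρ h1 (by omega)
      · simp only [Polynomial.coeff_mul]
        refine sum_eq_zero fun p hp => ?_
        rw [HasAntidiagonal.mem_antidiagonal] at hp
        -- Since `p.1 + p.2 = i` is at least half the total rank, one of the two indices is at least
        -- half the rank of its own summand.
        by_cases h3 : ρ E₁ - ρ (A ∩ E₁) ≤ 2 * p.1
        · rw [setKL_coeff_eq_zero ρ h1 h3, zero_mul]
        · rw [setKL_coeff_eq_zero ρ h2 (by omega), mul_zero]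
  · intro A hA
    rw [hr A hA, Polynomial.reflect_mul _ _ (natDegree_setKL_le ρ _ _) (natDegree_setKL_le ρ _ _),
      reflect_setKL hρ inter_subset_right, reflect_setKL hρ inter_subset_right]
    have := sum_Icc_split hd hA Subset.rfl
      (fun F => setChi ρ (A ∩ E₁) F * setKL ρ F E₁) (fun F => setChi ρ (A ∩ E₂) F * setKL ρ F E₂)
    rw [hE₁, hE₂] at this
    rw [← this]
    refine sum_congr rfl fun F hF => ?_
    rw [mem_Icc] at hF
    rw [setChi_mul hρ hd hadd hF.1 hF.2]
    ring

/-- Kazhdan–Lusztig polynomials are multiplicative on direct sums with finitely many summands. -/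
theorem setKL_biUnion {ι : Type*} {ρ : Finset α → ℕ} (hρ : Monotone ρ) (E : ι → Finset α)
    (hd : Pairwise (fun i j => Disjoint (E i) (E j)))
    (s : Finset ι) (hadd : ∀ t ⊆ s, ∀ S ⊆ t.biUnion E, ρ S = ∑ i ∈ t, ρ (S ∩ E i)) :
    setKL ρ ∅ (s.biUnion E) = ∏ i ∈ s, setKL ρ ∅ (E i) := by
  classical
  induction s using Finset.induction_on with
  | empty => simp [setKL_self]
  | insert i s hi ih =>
    have hdis : Disjoint (E i) (s.biUnion E) := by
      rw [disjoint_biUnion_right]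
      exact fun j hj => hd fun h => hi (h ▸ hj)
    have hsplit : ∀ S ⊆ E i ∪ s.biUnion E, ρ S = ρ (S ∩ E i) + ρ (S ∩ s.biUnion E) := by
      intro S hS
      rw [hadd _ Subset.rfl S (by rwa [biUnion_insert]), sum_insert hi,
        hadd s (subset_insert _ _) (S ∩ s.biUnion E) inter_subset_right]
      congr 1
      refine sum_congr rfl fun j hj => ?_
      rw [inter_assoc, inter_eq_right.2 (subset_biUnion_of_mem E hj)]
    rw [biUnion_insert, prod_insert hi, setKL_union hρ hdis hsplit (empty_subset _),
      empty_inter, empty_inter, ih fun t ht => hadd t (ht.trans (subset_insert _ _))]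

/-- Toggling `x` changes the sign of a term but not its rank, so the terms cancel in pairs. -/
theorem setChi_eq_zero_of_loop {ρ : Finset α → ℕ} {A B : Finset α} {x : α} (hxA : x ∉ A)
    (hxB : x ∈ B) (h : ∀ G, A ⊆ G → ρ (insert x G) = ρ G) : setChi ρ A B = 0 := by
  rw [setChi]
  refine sum_involution (fun S _ => if x ∈ S then S.erase x else insert x S) ?_ ?_ ?_ ?_
  · intro S hS
    rw [mem_Icc] at hS
    split_ifs with hx
    · have h1 : A ⊆ S.erase x := subset_erase.2 ⟨hS.1, hxA⟩
      have h2 := h _ h1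
      rw [insert_erase hx] at h2
      have h3 : S \ A = insert x (S.erase x \ A) := by
        rw [← insert_sdiff_of_notMem _ hxA, insert_erase hx]
      rw [h2, h3, card_insert_of_notMem (by simp)]
      ring
    · rw [h S hS.1, insert_sdiff_of_notMem _ hxA, card_insert_of_notMem (by simp [hx])]
      ring
  · intro S _ _
    split_ifs with hx
    · intro h'; rw [← h'] at hx; simp at hx
    · intro h'; rw [← h'] at hx; simp at hx
  · intro S hS
    rw [mem_Icc] at hS ⊢
    split_ifs with hx
    · exact ⟨subset_erase.2 ⟨hS.1, hxA⟩, (erase_subset _ _).trans hS.2⟩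
    · exact ⟨hS.1.trans (subset_insert _ _), insert_subset hxB hS.2⟩
  · intro S _
    by_cases hx : x ∈ S <;> simp [hx]

/-- Every term of the recursion vanishes: if `x ∈ F`, the characteristic polynomial does; otherwise
`x` is still a loop over `F` and induction applies. -/
theorem setKL_eq_zero_of_loop {ρ : Finset α → ℕ} {A B : Finset α} {x : α} (hxA : x ∉ A)
    (hxB : x ∈ B) (h : ∀ G, A ⊆ G → ρ (insert x G) = ρ G) : setKL ρ A B = 0 := by
  revert hxA h
  refine interval_induction (B := B) (p := fun A => x ∉ A →
    (∀ G, A ⊆ G → ρ (insert x G) = ρ G) → setKL ρ A B = 0) (fun A ih hxA h => ?_) A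
  have hne : A ≠ B := by rintro rfl; exact hxA hxB
  rw [setKL_of_ne ρ hne, sum_eq_zero, map_zero, neg_zero]
  intro F hF
  by_cases hx : x ∈ F
  · rw [setChi_eq_zero_of_loop hxA hx h, zero_mul]
  · rw [ih F hF hx fun G hG => h G ((mem_Ioc.1 hF).1.le.trans hG), mul_zero]

end DirectSum

/-! ### Contraction as a translation of intervals -/

section Shift

variable {α : Type*} [DecidableEq α]

theorem sum_Icc_sdiff {M : Type*} [AddCommMonoid M] {F A B : Finset α} (hFA : F ⊆ A)
    (hAB : A ⊆ B) (f : Finset α → M) :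
    ∑ S ∈ Icc (A \ F) (B \ F), f (S ∪ F) = ∑ S ∈ Icc A B, f S := by
  refine sum_bij' (fun S _ => S ∪ F) (fun S _ => S \ F) ?_ ?_ ?_ ?_ ?_
  · intro S hS
    rw [mem_Icc] at hS ⊢
    constructor
    · rw [← sdiff_union_of_subset hFA]
      exact union_subset_union_left hS.1
    · exact union_subset (hS.2.trans sdiff_subset) (hFA.trans hAB)
  · intro S hS
    rw [mem_Icc] at hS ⊢
    exact ⟨sdiff_subset_sdiff hS.1 Subset.rfl, sdiff_subset_sdiff hS.2 Subset.rfl⟩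
  · intro S hS
    rw [mem_Icc] at hS
    have h1 : Disjoint S F := disjoint_of_subset_left hS.2 sdiff_disjoint
    rw [union_sdiff_right, sdiff_eq_self_of_disjoint h1]
  · intro S hS
    rw [mem_Icc] at hS
    exact sdiff_union_of_subset (hFA.trans hS.1)
  · intro S _; rfl

theorem sum_Ioc_sdiff {M : Type*} [AddCommGroup M] {F A B : Finset α} (hFA : F ⊆ A)
    (hAB : A ⊆ B) (f : Finset α → M) :
    ∑ S ∈ Ioc (A \ F) (B \ F), f (S ∪ F) = ∑ S ∈ Ioc A B, f S := by
  rw [sum_Ioc_eq_sum_Icc_sub _ hAB, sum_Ioc_eq_sum_Icc_sub _ (sdiff_subset_sdiff hAB Subset.rfl),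
    sum_Icc_sdiff hFA hAB, sdiff_union_of_subset hFA]

theorem setChi_shift {ρ ρ' : Finset α → ℕ} {F : Finset α}
    (h : ∀ S, Disjoint S F → ρ' S + ρ F = ρ (S ∪ F)) {A B : Finset α} (hFA : F ⊆ A)
    (hAB : A ⊆ B) : setChi ρ' (A \ F) (B \ F) = setChi ρ A B := by
  rw [setChi, setChi, ← sum_Icc_sdiff hFA hAB]
  refine sum_congr rfl fun S hS => ?_
  have hSF : Disjoint S F := disjoint_of_subset_left (mem_Icc.1 hS).2 sdiff_disjoint
  have h1 := h _ hSF
  have h2 := h (B \ F) sdiff_disjoint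
  rw [sdiff_union_of_subset (hFA.trans hAB)] at h2
  have h3 : S \ (A \ F) = (S ∪ F) \ A := by
    ext x
    have h4 : x ∈ S → x ∉ F := fun h => disjoint_left.1 hSF h
    have h5 : x ∈ F → x ∈ A := fun h => hFA h
    simp only [mem_sdiff, mem_union]
    tauto
  rw [h3, show ρ' (B \ F) - ρ' S = ρ B - ρ (S ∪ F) by omega]

/-- Here `ρ'` plays the rank function of the contraction by `F`. The map `S ↦ S ∪ F` identifies the
two intervals, and the definitions involve only differences of values of the set functions. -/
theorem setKL_shift {ρ ρ' : Finset α → ℕ} {F : Finset α}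
    (h : ∀ S, Disjoint S F → ρ' S + ρ F = ρ (S ∪ F)) {A B : Finset α} (hFA : F ⊆ A)
    (hAB : A ⊆ B) : setKL ρ' (A \ F) (B \ F) = setKL ρ A B := by
  revert hFA hAB
  refine interval_induction (B := B) (p := fun A => F ⊆ A → A ⊆ B →
    setKL ρ' (A \ F) (B \ F) = setKL ρ A B) (fun A ih hFA hAB => ?_) A
  by_cases hne : A = B
  · subst hne; rw [setKL_self, setKL_self]
  have hne' : A \ F ≠ B \ F := fun h' => hne <| by
    rw [← sdiff_union_of_subset hFA, h', sdiff_union_of_subset (hFA.trans hAB)]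
  have h1 := h (A \ F) sdiff_disjoint
  have h2 := h (B \ F) sdiff_disjoint
  rw [sdiff_union_of_subset (hFA.trans hAB)] at h2
  rw [sdiff_union_of_subset hFA] at h1
  rw [setKL_of_ne _ hne, setKL_of_ne _ hne', ← sum_Ioc_sdiff hFA hAB,
    show ρ' (B \ F) - ρ' (A \ F) = ρ B - ρ A by omega]
  refine congrArg (fun p => -lowPart _ p) (sum_congr rfl fun S hS => ?_)
  rw [mem_Ioc] at hS
  have hSF : Disjoint S F := disjoint_of_subset_left hS.2 sdiff_disjoint
  have hS' : S ∪ F ∈ Ioc A B := by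
    rw [mem_Ioc]
    refine ⟨lt_of_le_of_ne ?_ ?_, union_subset (hS.2.trans sdiff_subset) (hFA.trans hAB)⟩
    · rw [← sdiff_union_of_subset hFA]
      exact union_subset_union_left hS.1.le
    · rintro rfl
      rw [union_sdiff_right, sdiff_eq_self_of_disjoint hSF] at hS
      exact lt_irrefl _ hS.1
  have hback : (S ∪ F) \ F = S := by rw [union_sdiff_right, sdiff_eq_self_of_disjoint hSF]
  rw [← ih _ hS' subset_union_right (mem_Ioc.1 hS').2,
    ← setChi_shift h hFA (mem_Ioc.1 hS').1.le, hback]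

end Shift

/-! ### Comparison with the polynomials of matroids -/

section Link

variable {α : Type*} [Fintype α]

theorem coe_rk (M : Matroid α) (A : Set α) : (rk M A : ℕ∞) = M.eRk A := by
  refine ENat.natCast_toNat (ne_top_of_le_ne_top ?_ (M.eRk_le_encard A))
  exact Set.encard_ne_top_iff.2 (Set.toFinite A)

theorem rk_mono (M : Matroid α) {A B : Set α} (h : A ⊆ B) : rk M A ≤ rk M B := by
  have := M.eRk_mono h
  rwa [← coe_rk, ← coe_rk, Nat.cast_le] at this

theorem rk_empty (M : Matroid α) : rk M ∅ = 0 := by simp [rk]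

/-- A basis `I` of `F` extends to a basis `K` of `S ∪ F`; then `K ∩ F = I`, and `K \ F` is a basis
of `S` in the contraction. -/
theorem rk_contract_add (M : Matroid α) (F S : Set α) (h : Disjoint S F) :
    rk (M.contract F) S + rk M F = rk M (S ∪ F) := by
  obtain ⟨I, hI⟩ := M.exists_isBasis' F
  obtain ⟨K, hK, hIK⟩ := hI.indep.subset_isBasis'_of_subset (hI.subset.trans Set.subset_union_right
    : I ⊆ S ∪ F)
  have h1 := hK.contract_isBasis' hI
    (hK.indep.subset (Set.union_subset Set.sdiff_subset hIK))
  rw [Set.union_sdiff_right, h.sdiff_eq_left] at h1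
  have h2 : I = K ∩ F := hI.eq_of_subset_indep (hK.indep.inter_right F)
    (Set.subset_inter hIK hI.subset) Set.inter_subset_right
  have h3 := Set.encard_sdiff_add_encard_inter K F
  rw [← h2, h1.encard_eq_eRk, hI.encard_eq_eRk, hK.encard_eq_eRk, ← coe_rk, ← coe_rk, ← coe_rk]
    at h3
  exact_mod_cast h3

theorem rk_restrict (M : Matroid α) {R A : Set α} (h : A ⊆ R) : rk (M.restrict R) A = rk M A := by
  rw [rk, rk, M.restrict_eRk_eq h]

theorem rk_insert_eq_of_mem_closure (M : Matroid α) {F G : Set α} {x : α}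
    (hx : x ∈ M.closure F) (h : F ⊆ G) : rk M (insert x G) = rk M G := by
  have hx' : x ∈ M.closure G := M.closure_subset_closure h hx
  rw [rk, rk, ← M.eRk_closure_eq (insert x G), M.closure_insert_eq_of_mem_closure hx',
    M.eRk_closure_eq]

variable [DecidableEq α]

theorem charPoly_restrict (M : Matroid α) (F : Finset α) :
    charPoly (M.restrict (F : Set α)) = setChi (fun S => rk M (S : Set α)) ∅ F := by
  classical
  rw [charPoly, setChi]
  refine sum_congr ?_ fun S hS => ?_
  · ext S; simp
  · rw [mem_Icc] at hS
    rw [Matroid.restrict_ground_eq, rk_restrict M subset_rfl, rk_restrict M (by exact_mod_cast hS.2),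
      sdiff_empty]

theorem setKL_contract (M : Matroid α) {F B : Finset α} (hFB : F ⊆ B) :
    setKL (fun S => rk (M.contract (F : Set α)) (S : Set α)) ∅ (B \ F)
      = setKL (fun S => rk M (S : Set α)) F B := by
  rw [show (∅ : Finset α) = F \ F by simp]
  refine setKL_shift (fun S hS => ?_) Subset.rfl hFB
  rw [coe_union]
  exact rk_contract_add M _ _ (disjoint_coe.2 hS)

/-- The Kazhdan–Lusztig polynomial of a loopless matroid, in terms of its rank function. -/
theorem klPoly_eq_setKL (M : Matroid α) (hM : M.Loopless) (E : Finset α) (hE : (E : Set α) = M.E) :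
    klPoly M = setKL (fun S => rk M (S : Set α)) ∅ E := by
  classical
  induction hn : E.card using Nat.strong_induction_on generalizing M E with
  | _ n ih =>
  subst hn
  rw [klPoly]
  by_cases h0 : E = ∅
  · subst h0
    rw [if_pos, setKL_self]
    rw [← hE, coe_empty, rk_empty]
  -- A loopless matroid with nonempty ground set has positive rank, so the normalisations at rank
  -- zero and at `A = B` agree.
  have hne : rk M M.E ≠ 0 := by
    obtain ⟨x, hx⟩ := nonempty_iff_ne_empty.2 h0
    have hxE : x ∈ M.E := hE ▸ (mem_coe.2 hx)
    have h1 : M.eRk {x} = 1 := Matroid.eRk_singleton_eq hxE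
    have h2 := M.eRk_mono (Set.singleton_subset_iff.2 hxE)
    rw [h1, ← coe_rk] at h2
    intro h3
    rw [h3] at h2
    simp at h2
  rw [if_neg hne, setKL_of_ne _ (Ne.symm h0)]
  have hsum : ∑ F : {F : Set α // M.IsFlat F ∧ F.Nonempty},
        charPoly (M.restrict F.1) * klPoly (M.contract F.1)
      = ∑ F ∈ Ioc ∅ E, setChi (fun S => rk M (S : Set α)) ∅ F *
        setKL (fun S => rk M (S : Set α)) F E := by
    -- If `F` is not a flat, any element of its closure outside `F` is a loop of the contraction.
    have hterm : ∀ F ∈ Ioc ∅ E, ¬ M.IsFlat (F : Set α) →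
        setKL (fun S => rk M (S : Set α)) F E = 0 := by
      intro F hF hnf
      rw [mem_Ioc] at hF
      have hFE : (F : Set α) ⊆ M.E := by rw [← hE]; exact_mod_cast hF.2
      rw [Matroid.isFlat_iff_closure_eq] at hnf
      have hss := (M.subset_closure (F : Set α) hFE)
      obtain ⟨x, hx, hxF⟩ := Set.exists_of_ssubset (lt_of_le_of_ne hss (Ne.symm hnf))
      refine setKL_eq_zero_of_loop (x := x) (by simpa using hxF) ?_ fun G hG => ?_
      · have := M.closure_subset_ground _ hx
        rw [← hE] at this
        exact_mod_cast this
      · rw [coe_insert]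
        exact rk_insert_eq_of_mem_closure M hx (by exact_mod_cast hG)
    rw [← sum_filter_add_sum_filter_not (Ioc ∅ E) (fun F : Finset α => M.IsFlat (F : Set α)),
      sum_eq_zero (s := filter (fun F : Finset α => ¬ M.IsFlat (F : Set α)) (Ioc ∅ E)), add_zero]
    · refine sum_bij (fun (F : {F : Set α // M.IsFlat F ∧ F.Nonempty}) _ => F.1.toFinset) ?_ ?_ ?_ ?_
      · rintro ⟨F, hF, hF0⟩ -
        simp only [mem_filter, mem_Ioc, Set.coe_toFinset]
        refine ⟨⟨?_, ?_⟩, hF⟩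
        · rw [empty_ssubset]; simpa using hF0
        · have := hF.subset_ground
          rw [← hE] at this
          intro x hx
          exact_mod_cast this (Set.mem_toFinset.1 hx)
      · rintro ⟨F, hF⟩ - ⟨G, hG⟩ - h
        exact Subtype.ext (Set.toFinset_inj.1 h)
      · intro F hF
        simp only [mem_filter, mem_Ioc, empty_ssubset] at hF
        exact ⟨⟨F, hF.2, by simpa using hF.1.1⟩, mem_univ _, by simp⟩
      · rintro ⟨F, hF, hF0⟩ -
        lift F to Finset α using Set.toFinite F
        have hFE : F ⊆ E := by
          have := hF.subset_ground
          rw [← hE] at this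
          exact_mod_cast this
        simp only [toFinset_coe]
        rw [charPoly_restrict, ih (E \ F).card _ (M.contract (F : Set α)) _ (E \ F) _ rfl,
          setKL_contract M hFE]
        · refine card_lt_card (sdiff_ssubset hFE (by simpa using hF0))
        · rw [Matroid.loopless_iff, Matroid.contract_loops_eq, hF.closure, Set.sdiff_self]
        · rw [Matroid.contract_ground, ← hE, coe_sdiff]
    · intro F hF
      rw [mem_filter] at hF
      rw [hterm F hF.1 hF.2, mul_zero]
  rw [hsum]
  have hr : rk M M.E = rk M (E : Set α) - rk M ((∅ : Finset α) : Set α) := by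
    rw [hE, coe_empty, rk_empty, Nat.sub_zero]
  rw [← map_neg, ← hr]
  simp only [lowPart, LinearMap.coe_mk, AddHom.coe_mk, Polynomial.coeff_neg]

end Link

/-! ### Expansion into functionals supported on chains -/

section ChainSpan

variable {α : Type*}

/-- The span of the functionals on set functions that only depend on the values on the members of
some chain of sets between `A` and `B`. -/
noncomputable def chainSpan (A B : Finset α) : Submodule ℤ ((Finset α → ℕ) → ℤ[X]) :=
  Submodule.span ℤ {Φ | ∃ c : Set (Finset α), IsChain (· ⊆ ·) c ∧ c ⊆ Set.Icc A B ∧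
    DependsOn Φ c}

theorem isChain_union_Icc {A F B : Finset α} {c d : Set (Finset α)} (hc : IsChain (· ⊆ ·) c)
    (hd : IsChain (· ⊆ ·) d) (hcF : c ⊆ Set.Icc A F) (hdF : d ⊆ Set.Icc F B) :
    IsChain (· ⊆ ·) (c ∪ d) := by
  rintro S (hS | hS) T (hT | hT) hne
  · exact hc hS hT hne
  · exact .inl ((hcF hS).2.trans (hdF hT).1)
  · exact .inr ((hcF hT).2.trans (hdF hS).1)
  · exact hd hS hT hne

/-- A chain in `[A, F]` and a chain in `[F, B]` together form a chain in `[A, B]`. -/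
theorem mul_mem_chainSpan {A F B : Finset α} (hAF : A ⊆ F) (hFB : F ⊆ B)
    {Φ Ψ : (Finset α → ℕ) → ℤ[X]} (hΦ : Φ ∈ chainSpan A F) (hΨ : Ψ ∈ chainSpan F B) :
    Φ * Ψ ∈ chainSpan A B := by
  refine Submodule.span_induction₂ (p := fun Φ Ψ _ _ => Φ * Ψ ∈ chainSpan A B)
    ?_ ?_ ?_ ?_ ?_ ?_ ?_ hΦ hΨ
  · rintro Φ Ψ ⟨c, hc, hcF, hΦ⟩ ⟨d, hd, hdF, hΨ⟩
    refine Submodule.subset_span ⟨c ∪ d, isChain_union_Icc hc hd hcF hdF, ?_, ?_⟩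
    · rintro S (hS | hS)
      · exact ⟨(hcF hS).1, (hcF hS).2.trans hFB⟩
      · exact ⟨hAF.trans (hdF hS).1, (hdF hS).2⟩
    · intro ρ ρ' h
      simp only [Pi.mul_apply]
      rw [hΦ fun S hS => h S (.inl hS), hΨ fun S hS => h S (.inr hS)]
  · intro Ψ _; rw [zero_mul]; exact Submodule.zero_mem _
  · intro Φ _; rw [mul_zero]; exact Submodule.zero_mem _
  · intro Φ Φ' Ψ _ _ _ h h'; rw [add_mul]; exact Submodule.add_mem _ h h'
  · intro Φ Ψ Ψ' _ _ _ h h'; rw [mul_add]; exact Submodule.add_mem _ h h'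
  · intro r Φ Ψ _ _ h; rw [smul_mul_assoc]; exact Submodule.smul_mem _ _ h
  · intro r Φ Ψ _ _ h; rw [mul_smul_comm]; exact Submodule.smul_mem _ _ h

/-- The truncation bound depends on `ρ A` and `ρ B` only, and both ends can be added to any chain in
the interval. -/
theorem lowPart_mem_chainSpan {A B : Finset α} (hAB : A ⊆ B)
    {Φ : (Finset α → ℕ) → ℤ[X]} (hΦ : Φ ∈ chainSpan A B) :
    (fun ρ => lowPart (ρ B - ρ A) (Φ ρ)) ∈ chainSpan A B := by
  refine Submodule.span_induction
    (p := fun Φ _ => (fun ρ => lowPart (ρ B - ρ A) (Φ ρ)) ∈ chainSpan A B) ?_ ?_ ?_ ?_ hΦ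
  · rintro Φ ⟨c, hc, hcF, hΦ⟩
    refine Submodule.subset_span ⟨insert A (insert B c), ?_, ?_, ?_⟩
    · refine (hc.insert fun S hS _ => .inr (hcF hS).2).insert ?_
      rintro S (rfl | hS) _
      · exact .inl hAB
      · exact .inl (hcF hS).1
    · rintro S (rfl | rfl | hS)
      · exact ⟨le_rfl, hAB⟩
      · exact ⟨hAB, le_rfl⟩
      · exact hcF hS
    · intro ρ ρ' h
      have h1 := h A (by simp)
      have h2 := h B (by simp)
      have h3 := hΦ (x := ρ) (y := ρ') fun S hS => h S (.inr (.inr hS))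
      simp only [h1, h2, h3]
  · simp only [Pi.zero_apply, map_zero]; exact Submodule.zero_mem _
  · intro Φ Ψ _ _ h h'
    simp only [Pi.add_apply, map_add]
    exact Submodule.add_mem _ h h'
  · intro r Φ _ h
    simp only [Pi.smul_apply, map_smul]
    exact Submodule.smul_mem _ r h

variable [DecidableEq α]

theorem setChi_mem_chainSpan {A B : Finset α} (hAB : A ⊆ B) :
    (fun ρ => setChi ρ A B) ∈ chainSpan A B := by
  have : (fun ρ : Finset α → ℕ => setChi ρ A B)
      = ∑ S ∈ Icc A B, fun ρ => (-1) ^ (S \ A).card * Polynomial.X ^ (ρ B - ρ S) := by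
    ext1 ρ; rw [Finset.sum_apply, setChi]
  rw [this]
  refine Submodule.sum_mem _ fun S hS => Submodule.subset_span ⟨{S, B}, ?_, ?_, ?_⟩
  · refine IsChain.insert (Set.subsingleton_singleton.isChain) ?_
    rintro T rfl _
    exact .inl (mem_Icc.1 hS).2
  · rintro T (rfl | rfl)
    · exact mem_Icc.1 hS
    · exact ⟨hAB, le_rfl⟩
  · intro ρ ρ' h
    have h1 := h S (by simp)
    have h2 := h B (by simp)
    simp only [h1, h2]

/-- The recursion uses only sums, products over adjacent intervals `[A, F]` and `[F, B]`, and
truncation, all of which preserve the span. This is what reduces identities between rank functions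
to chains. -/
theorem setKL_mem_chainSpan {A B : Finset α} (hAB : A ⊆ B) :
    (fun ρ => setKL ρ A B) ∈ chainSpan A B := by
  revert hAB
  refine interval_induction (B := B) (p := fun A => A ⊆ B →
    (fun ρ => setKL ρ A B) ∈ chainSpan A B) (fun A ih hAB => ?_) A
  by_cases hne : A = B
  · subst hne
    simp only [setKL_self]
    exact Submodule.subset_span ⟨∅, by simp [IsChain], by simp, fun _ _ _ => rfl⟩
  simp only [setKL_of_ne _ hne]
  have h : (∑ F ∈ Ioc A B, (fun ρ => setChi ρ A F) * fun ρ => setKL ρ F B) ∈ chainSpan A B := by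
    refine Submodule.sum_mem _ fun F hF => ?_
    have hF' := mem_Ioc.1 hF
    exact mul_mem_chainSpan hF'.1.le hF'.2 (setChi_mem_chainSpan hF'.1.le) (ih F hF hF'.2)
  have h2 := Submodule.neg_mem _ (lowPart_mem_chainSpan hAB h)
  convert h2 using 1
  ext1 ρ
  simp [Finset.sum_apply]

end ChainSpan

/-! ### Spitzer's identity in commutative Rota–Baxter algebras -/

section Spitzer

variable {R : Type*} [CommRing R] [Algebra ℚ R] {β : Type*} [DecidableEq β]

/-- The sum over all orderings `i₁, …, iₖ` of `I` of `P (x i₁ * P (x i₂ * ⋯ P (x iₖ)))`. -/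
noncomputable def orderSum (P : R →ₗ[ℚ] R) (x : β → R) (I : Finset β) : R :=
  if I = ∅ then 1 else ∑ i : {i // i ∈ I}, P (x i.1 * orderSum P x (I.erase i.1))
termination_by I.card
decreasing_by exact card_erase_lt_of_mem i.2

/-- The weighted sum over all set partitions of `I` of the products of `P (∏ i ∈ J, x i)` over the
blocks `J` of the partition, each block having weight `(|J| - 1)!`. -/
noncomputable def cycleSum (P : R →ₗ[ℚ] R) (x : β → R) (I : Finset β) : R :=
  -- Splitting off the block `J` that contains a fixed `i ∈ I` gives the weight `(|J| - 1)!`;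
  -- averaging over `i` turns it into `|J|! / |I|`.
  if I = ∅ then 1 else (1 / (I.card : ℚ)) •
    ∑ J : {J // J ∈ I.powerset.filter (·.Nonempty)},
      (J.1.card ! : ℚ) • (P (∏ i ∈ J.1, x i) * cycleSum P x (I \ J.1))
termination_by I.card
decreasing_by
  have h := mem_filter.1 J.2
  exact card_lt_card (sdiff_ssubset (mem_powerset.1 h.1) h.2)

variable (P : R →ₗ[ℚ] R) (x : β → R)

theorem orderSum_empty : orderSum P x ∅ = 1 := by rw [orderSum, if_pos rfl]

theorem orderSum_of_nonempty {I : Finset β} (h : I.Nonempty) :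
    orderSum P x I = ∑ i ∈ I, P (x i * orderSum P x (I.erase i)) := by
  rw [orderSum, if_neg h.ne_empty, ← sum_coe_sort I]

theorem cycleSum_empty : cycleSum P x ∅ = 1 := by rw [cycleSum, if_pos rfl]

theorem cycleSum_of_nonempty {I : Finset β} (h : I.Nonempty) :
    cycleSum P x I = (1 / (I.card : ℚ)) • ∑ J ∈ I.powerset with J.Nonempty,
      (J.card ! : ℚ) • (P (∏ i ∈ J, x i) * cycleSum P x (I \ J)) := by
  rw [cycleSum, if_neg h.ne_empty, ← sum_coe_sort (I.powerset.filter (·.Nonempty))]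

theorem sum_powerset_sum_sdiff {M : Type*} [AddCommMonoid M] (I : Finset β)
    (f : Finset β → β → M) :
    ∑ J ∈ I.powerset, ∑ i ∈ I \ J, f (insert i J) i = ∑ K ∈ I.powerset, ∑ i ∈ K, f K i := by
  rw [sum_sigma', sum_sigma']
  refine sum_bij' (fun p _ => ⟨insert p.2 p.1, p.2⟩) (fun p _ => ⟨p.1.erase p.2, p.2⟩) ?_ ?_ ?_ ?_ ?_
  · rintro ⟨J, i⟩ h
    simp only [mem_sigma, mem_powerset, mem_sdiff] at h ⊢
    exact ⟨insert_subset h.2.1 h.1, mem_insert_self _ _⟩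
  · rintro ⟨K, i⟩ h
    simp only [mem_sigma, mem_powerset, mem_sdiff] at h ⊢
    exact ⟨(erase_subset _ _).trans h.1, h.1 h.2, notMem_erase _ _⟩
  · rintro ⟨J, i⟩ h
    simp only [mem_sigma, mem_powerset, mem_sdiff] at h
    simp [erase_insert h.2.2]
  · rintro ⟨K, i⟩ h
    simp only [mem_sigma, mem_powerset] at h
    simp [insert_erase h.2]
  · rintro ⟨J, i⟩ _; rfl

theorem orderSum_mem (A : Subalgebra ℚ R) (hP : ∀ u ∈ A, P u ∈ A) (hx : ∀ i, x i ∈ A)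
    (I : Finset β) : orderSum P x I ∈ A := by
  induction I using Finset.strongInduction with
  | H I ih =>
    rcases I.eq_empty_or_nonempty with rfl | hI
    · rw [orderSum_empty]; exact one_mem _
    · rw [orderSum_of_nonempty P x hI]
      exact sum_mem fun i hi => hP _ (mul_mem (hx i) (ih _ (erase_ssubset hi)))

/-- The recursion behind Spitzer's identity in commutative Rota–Baxter algebras. -/
theorem card_smul_orderSum (A : Subalgebra ℚ R) (hP : ∀ u ∈ A, P u ∈ A) (hx : ∀ i, x i ∈ A)
    (hRB : ∀ u ∈ A, ∀ v ∈ A, P u * P v = P (P u * v + u * P v - u * v)) (I : Finset β) :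
    (I.card : ℚ) • orderSum P x I = ∑ J ∈ I.powerset with J.Nonempty,
      (J.card ! : ℚ) • (P (∏ i ∈ J, x i) * orderSum P x (I \ J)) := by
  induction I using Finset.strongInduction with
  | H I ih =>
  rcases I.eq_empty_or_nonempty with rfl | hI
  · simp [powerset_empty, filter_singleton]
  -- The outermost `P` of each summand of `orderSum P x (I \ J)` is combined with `P (∏ i ∈ J, x i)`
  -- by the Rota–Baxter relation; its three terms give the three sums.
  have hterm : ∀ J ∈ I.powerset.filter (·.Nonempty),
      P (∏ i ∈ J, x i) * orderSum P x (I \ J)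
        = ∑ i ∈ I \ J, P (x i * (P (∏ i ∈ J, x i) * orderSum P x (I.erase i \ J)))
          + P ((∏ i ∈ J, x i) * orderSum P x (I \ J))
          - ∑ i ∈ I \ J, P ((∏ i ∈ insert i J, x i) * orderSum P x (I \ insert i J)) := by
    intro J hJ
    have hxJ : ∏ i ∈ J, x i ∈ A := prod_mem fun i _ => hx i
    rcases (I \ J).eq_empty_or_nonempty with h | h
    · simp [h, orderSum_empty]
    · have hN := orderSum_of_nonempty P x h
      have h1 : P ((∏ i ∈ J, x i) * orderSum P x (I \ J)) = ∑ i ∈ I \ J,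
          P ((∏ i ∈ J, x i) * P (x i * orderSum P x ((I \ J).erase i))) := by
        rw [hN, mul_sum, map_sum]
      rw [h1, hN, mul_sum, ← sum_add_distrib, ← sum_sub_distrib]
      refine sum_congr rfl fun i hi => ?_
      rw [mem_sdiff] at hi
      have hs : (I \ J).erase i = I.erase i \ J := by rw [erase_sdiff_comm]
      have hs' : I \ insert i J = I.erase i \ J := by rw [sdiff_insert, erase_sdiff_comm]
      rw [hRB _ hxJ _ (mul_mem (hx i) (orderSum_mem P x A hP hx _)), prod_insert hi.2, hs, hs',
        ← map_add, ← map_sub]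
      congr 1
      ring
  -- After exchanging the sums, the inner sum over `J` is the induction hypothesis for `I.erase i`,
  -- whence the factor `|I| - 1`.
  have hS1 : ∑ J ∈ I.powerset with J.Nonempty, (J.card ! : ℚ) •
      ∑ i ∈ I \ J, P (x i * (P (∏ i ∈ J, x i) * orderSum P x (I.erase i \ J)))
      = ((I.card : ℚ) - 1) • orderSum P x I := by
    simp only [smul_sum]
    rw [orderSum_of_nonempty P x hI, smul_sum,
      sum_comm' (t' := I) (s' := fun i => (I.erase i).powerset.filter (·.Nonempty))]
    · refine sum_congr rfl fun i hi => ?_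
      have := ih _ (erase_ssubset hi)
      rw [card_erase_of_mem hi, Nat.cast_sub (card_pos.2 hI), Nat.cast_one] at this
      rw [← map_smul, ← mul_smul_comm, this, mul_sum, map_sum]
      refine sum_congr rfl fun J _ => ?_
      rw [mul_smul_comm, map_smul]
    · intro J i
      simp only [mem_filter, mem_powerset, mem_sdiff, subset_erase]
      tauto
  set T : Finset β → R := fun K => P ((∏ i ∈ K, x i) * orderSum P x (I \ K)) with hT
  have hfilter : ∀ f : Finset β → R, ∑ J ∈ I.powerset with J.Nonempty, f J
      = ∑ J ∈ I.powerset, f J - f ∅ := by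
    intro f
    rw [eq_sub_iff_add_eq', ← sum_filter_add_sum_filter_not I.powerset (·.Nonempty) f, add_comm]
    congr 1
    have : I.powerset.filter (fun J => ¬ J.Nonempty) = {∅} := by
      ext J
      simp only [mem_filter, mem_powerset, not_nonempty_iff_eq_empty, mem_singleton]
      exact ⟨fun h => h.2, fun h => ⟨h ▸ empty_subset _, h⟩⟩
    rw [this, sum_singleton]
  -- Each `K` arises as `insert i J` in `|K|` ways with weight `(|K| - 1)!`, so it gets the weight
  -- `|K|!` again. Only `J = ∅` is missing; its terms, the singletons `K`, add up to `orderSum P x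
  -- I`.
  have hS3 : ∑ J ∈ I.powerset with J.Nonempty, (J.card ! : ℚ) • ∑ i ∈ I \ J, T (insert i J)
      = ∑ J ∈ I.powerset with J.Nonempty, (J.card ! : ℚ) • T J - orderSum P x I := by
    rw [hfilter (fun J => (J.card ! : ℚ) • ∑ i ∈ I \ J, T (insert i J))]
    congr 1
    · have h1 : ∀ J ∈ I.powerset, (J.card ! : ℚ) • ∑ i ∈ I \ J, T (insert i J)
          = ∑ i ∈ I \ J, (((insert i J).card - 1)! : ℚ) • T (insert i J) := by
        intro J _
        rw [smul_sum]
        refine sum_congr rfl fun i hi => ?_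
        rw [card_insert_of_notMem (mem_sdiff.1 hi).2, Nat.add_sub_cancel]
      rw [sum_congr rfl h1, sum_powerset_sum_sdiff I (fun K _ => ((K.card - 1)! : ℚ) • T K),
        sum_filter]
      refine sum_congr rfl fun K _ => ?_
      rw [sum_const, ← Nat.cast_smul_eq_nsmul ℚ, smul_smul]
      split_ifs with hK
      · rw [← Nat.mul_factorial_pred (card_pos.2 hK).ne', Nat.cast_mul]
      · rw [not_nonempty_iff_eq_empty.1 hK]; simp
    · rw [orderSum_of_nonempty P x hI]
      simp [hT, sdiff_singleton_eq_erase]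
  rw [sum_congr rfl fun J hJ => by rw [hterm J hJ]]
  simp only [smul_sub, smul_add, sum_sub_distrib, sum_add_distrib]
  rw [hS1, hS3, sub_smul, one_smul]
  abel

theorem orderSum_eq_cycleSum (A : Subalgebra ℚ R) (hP : ∀ u ∈ A, P u ∈ A) (hx : ∀ i, x i ∈ A)
    (hRB : ∀ u ∈ A, ∀ v ∈ A, P u * P v = P (P u * v + u * P v - u * v)) (I : Finset β) :
    orderSum P x I = cycleSum P x I := by
  induction I using Finset.strongInduction with
  | H I ih =>
  rcases I.eq_empty_or_nonempty with rfl | hI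
  · rw [orderSum_empty, cycleSum_empty]
  have hne : (I.card : ℚ) ≠ 0 := by exact_mod_cast (card_pos.2 hI).ne'
  have h : ∑ J ∈ I.powerset with J.Nonempty,
      (J.card ! : ℚ) • (P (∏ i ∈ J, x i) * cycleSum P x (I \ J))
      = (I.card : ℚ) • orderSum P x I := by
    rw [card_smul_orderSum P x A hP hx hRB]
    refine sum_congr rfl fun J hJ => ?_
    rw [mem_filter, mem_powerset] at hJ
    rw [ih _ (sdiff_ssubset hJ.1 hJ.2)]
  rw [cycleSum_of_nonempty P x hI, h, smul_smul, one_div, inv_mul_cancel₀ hne, one_smul]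

variable {R' : Type*} [CommRing R'] [Algebra ℚ R'] (P' : R' →ₗ[ℚ] R') (f : R →ₐ[ℚ] R')

theorem map_orderSum (hf : ∀ u, f (P u) = P' (f u)) (I : Finset β) :
    f (orderSum P x I) = orderSum P' (fun i => f (x i)) I := by
  induction I using Finset.strongInduction with
  | H I ih =>
  rcases I.eq_empty_or_nonempty with rfl | hI
  · rw [orderSum_empty, orderSum_empty, map_one]
  rw [orderSum_of_nonempty _ _ hI, orderSum_of_nonempty _ _ hI, map_sum]
  refine sum_congr rfl fun i hi => ?_
  rw [hf, map_mul, ih _ (erase_ssubset hi)]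

theorem map_cycleSum (hf : ∀ u, f (P u) = P' (f u)) (I : Finset β) :
    f (cycleSum P x I) = cycleSum P' (fun i => f (x i)) I := by
  induction I using Finset.strongInduction with
  | H I ih =>
  rcases I.eq_empty_or_nonempty with rfl | hI
  · rw [cycleSum_empty, cycleSum_empty, map_one]
  rw [cycleSum_of_nonempty _ _ hI, cycleSum_of_nonempty _ _ hI, map_smul, map_sum]
  congr 1
  refine sum_congr rfl fun J hJ => ?_
  rw [mem_filter, mem_powerset] at hJ
  rw [map_smul, map_mul, hf, map_prod, ih _ (sdiff_ssubset hJ.1 hJ.2)]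

end Spitzer

/-! ### The positive part as a Rota–Baxter operator -/

section PosPart

/-- The linear extension of a function to a monoid algebra. -/
noncomputable def linExt {G : Type*} (g : G → ℚ[X]) : AddMonoidAlgebra ℚ G →ₗ[ℚ] ℚ[X] where
  toFun u := Finsupp.linearCombination ℚ g u.coeff
  map_add' u v := by simp
  map_smul' r u := by simp

theorem linExt_single {G : Type*} (g : G → ℚ[X]) (a : G) (r : ℚ) :
    linExt g (AddMonoidAlgebra.single a r) = r • g a := by
  simp [linExt]

/-- The linear operator on formal combinations of integer functions that replaces each function
by its positive part. -/
noncomputable def posMap (ι : Type*) :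
    AddMonoidAlgebra ℚ (ι → ℤ) →ₗ[ℚ] AddMonoidAlgebra ℚ (ι → ℤ) :=
  AddMonoidAlgebra.mapDomainLinearMap ℚ ℚ fun h i => max (h i) 0

theorem posMap_single {ι : Type*} (h : ι → ℤ) (r : ℚ) :
    posMap ι (AddMonoidAlgebra.single h r)
      = AddMonoidAlgebra.single (fun i => max (h i) 0) r := by
  simp [posMap]

variable {ι : Type*} [Preorder ι]

/-- The additive monoid of monotone integer functions. -/
def monotoneSubmonoid (ι : Type*) [Preorder ι] : AddSubmonoid (ι → ℤ) where
  carrier := {h | Monotone h}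
  add_mem' := fun h h' => Monotone.add h h'
  zero_mem' := monotone_const

/-- The subalgebra of formal combinations of monotone functions. -/
noncomputable def monotoneSubalgebra (ι : Type*) [Preorder ι] :
    Subalgebra ℚ (AddMonoidAlgebra ℚ (ι → ℤ)) :=
  (AddMonoidAlgebra.mapDomainAlgHom ℚ ℚ (monotoneSubmonoid ι).subtype).range

theorem single_mem_monotoneSubalgebra {h : ι → ℤ} (hh : Monotone h) (r : ℚ) :
    AddMonoidAlgebra.single h r ∈ monotoneSubalgebra ι :=
  ⟨AddMonoidAlgebra.single ⟨h, hh⟩ r, by simp⟩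

theorem monotoneSubalgebra_induction {p : AddMonoidAlgebra ℚ (ι → ℤ) → Prop} (h0 : p 0)
    (hadd : ∀ u v, p u → p v → p (u + v))
    (hs : ∀ h : ι → ℤ, Monotone h → ∀ r, p (AddMonoidAlgebra.single h r))
    {u : AddMonoidAlgebra ℚ (ι → ℤ)} (hu : u ∈ monotoneSubalgebra ι) : p u := by
  obtain ⟨v, rfl⟩ := hu
  induction v using AddMonoidAlgebra.induction_linear with
  | zero => simpa using h0
  | add u v hu hv => rw [map_add]; exact hadd _ _ hu hv
  | single h r => simpa using hs h.1 h.2 r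

theorem posMap_mem (u : AddMonoidAlgebra ℚ (ι → ℤ)) (hu : u ∈ monotoneSubalgebra ι) :
    posMap ι u ∈ monotoneSubalgebra ι := by
  refine monotoneSubalgebra_induction (p := fun u => posMap ι u ∈ monotoneSubalgebra ι)
    ?_ ?_ ?_ hu
  · rw [map_zero]; exact zero_mem _
  · intro u v hu hv; rw [map_add]; exact add_mem hu hv
  · intro h hh r
    rw [posMap_single]
    exact single_mem_monotoneSubalgebra (fun i j hij => max_le_max_right 0 (hh hij)) r

/-- On a chain, taking positive parts of monotone functions is a Rota–Baxter operator. -/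
theorem posMap_rotaBaxter (htot : ∀ i j : ι, i ≤ j ∨ j ≤ i) (u : AddMonoidAlgebra ℚ (ι → ℤ))
    (hu : u ∈ monotoneSubalgebra ι) (v : AddMonoidAlgebra ℚ (ι → ℤ))
    (hv : v ∈ monotoneSubalgebra ι) :
    posMap ι u * posMap ι v = posMap ι (posMap ι u * v + u * posMap ι v - u * v) := by
  refine monotoneSubalgebra_induction (p := fun u =>
    posMap ι u * posMap ι v = posMap ι (posMap ι u * v + u * posMap ι v - u * v)) ?_ ?_ ?_ hu
  · simp
  · intro u u' h h'
    rw [map_add, add_mul, h, h', ← map_add]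
    congr 1; ring
  intro s hs r
  refine monotoneSubalgebra_induction (p := fun v =>
    posMap ι (AddMonoidAlgebra.single s r) * posMap ι v
      = posMap ι (posMap ι (AddMonoidAlgebra.single s r) * v
        + AddMonoidAlgebra.single s r * posMap ι v - AddMonoidAlgebra.single s r * v)) ?_ ?_ ?_ hv
  · simp
  · intro u u' h h'
    rw [map_add, mul_add, h, h', ← map_add]
    congr 1; ring
  intro t ht q
  simp only [posMap_single, AddMonoidAlgebra.single_mul_single, map_add, map_sub]
  -- On a chain, monotone `s` and `t` cannot have both a place with `s < 0 < t` and a place with `t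
  -- < 0 < s`. If the former is absent, then `s⁺ + t⁺ = (s + t⁺)⁺` and `(s⁺ + t)⁺ = (s + t)⁺`; the
  -- other case is symmetric.
  by_cases hc : ∀ i, 0 < t i → 0 ≤ s i
  · have h1 : (fun i => max (s i) 0) + (fun i => max (t i) 0)
        = fun i => max ((s + fun i => max (t i) 0) i) 0 := by
      ext i
      have := hc i
      simp only [Pi.add_apply]
      omega
    have h2 : (fun i => max (((fun i => max (s i) 0) + t) i) 0) = fun i => max ((s + t) i) 0 := by
      ext i
      have := hc i
      simp only [Pi.add_apply]
      omega
    rw [h1, h2]; ring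
  · push Not at hc
    obtain ⟨j, hj, hj'⟩ := hc
    have hc' : ∀ i, 0 < s i → 0 ≤ t i := by
      intro i hi
      rcases htot i j with h | h
      · have := hs h; omega
      · have := ht h; omega
    have h1 : (fun i => max (s i) 0) + (fun i => max (t i) 0)
        = fun i => max (((fun i => max (s i) 0) + t) i) 0 := by
      ext i
      have := hc' i
      simp only [Pi.add_apply]
      omega
    have h2 : (fun i => max ((s + fun i => max (t i) 0) i) 0) = fun i => max ((s + t) i) 0 := by
      ext i
      have := hc' i
      simp only [Pi.add_apply]
      omega
    rw [h1, h2]; ring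

end PosPart

/-! ### From chains to Kazhdan–Lusztig functionals -/

section Transfer

variable {α : Type*} {β : Type*} [DecidableEq β]

/-- The rank function with given nullity function. -/
def rankOfNullity (f : Finset α → ℤ) (S : Finset α) : ℕ := (S.card - f S).toNat

theorem linExt_orderSum_eq_of_dependsOn {c : Set (Finset α)} (hc : IsChain (· ⊆ ·) c)
    {Φ : (Finset α → ℕ) → ℤ[X]} (hΦ : DependsOn Φ c)
    (x : β → Finset α → ℤ) (hx : ∀ i, Monotone (x i)) (I : Finset β) :
    linExt (fun f => (Φ (rankOfNullity f)).map (Int.castRingHom ℚ))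
        (orderSum (posMap _) (fun i => AddMonoidAlgebra.single (x i) 1) I)
      = linExt (fun f => (Φ (rankOfNullity f)).map (Int.castRingHom ℚ))
        (cycleSum (posMap _) (fun i => AddMonoidAlgebra.single (x i) 1) I) := by
  classical
  set N := orderSum (posMap _) (fun i => AddMonoidAlgebra.single (x i) (1 : ℚ)) I with hN
  set U := cycleSum (posMap _) (fun i => AddMonoidAlgebra.single (x i) (1 : ℚ)) I with hU
  -- Restriction to the chain `c` is additive and commutes with positive parts, so it carries both
  -- sums to the corresponding sums over `c`, where the Rota–Baxter relation is available.
  let res : (Finset α → ℤ) →+ (c → ℤ) :=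
    { toFun := fun h S => h S.1, map_zero' := rfl, map_add' := fun _ _ => rfl }
  let F : AddMonoidAlgebra ℚ (Finset α → ℤ) →ₐ[ℚ] AddMonoidAlgebra ℚ (c → ℤ) :=
    AddMonoidAlgebra.mapDomainAlgHom ℚ ℚ res
  have hF : ∀ h r, F (AddMonoidAlgebra.single h r) = AddMonoidAlgebra.single (res h) r := by
    intro h r; simp [F]
  have hFP : ∀ u, F (posMap _ u) = posMap _ (F u) := by
    intro u
    induction u using AddMonoidAlgebra.induction_linear with
    | zero => simp
    | add u v hu hv => simp only [map_add, hu, hv]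
    | single h r => rw [posMap_single, hF, hF, posMap_single]; rfl
  -- The extension by `0` off the chain is immaterial, since `Φ` only depends on the values on `c`.
  let g : (c → ℤ) → ℚ[X] := fun h =>
    (Φ (rankOfNullity fun S => if hS : S ∈ c then h ⟨S, hS⟩ else 0)).map (Int.castRingHom ℚ)
  have hg : ∀ u, linExt (fun f => (Φ (rankOfNullity f)).map (Int.castRingHom ℚ)) u
      = linExt g (F u) := by
    intro u
    induction u using AddMonoidAlgebra.induction_linear with
    | zero => simp
    | add u v hu hv => simp only [map_add, hu, hv]
    | single h r =>
      rw [hF, linExt_single, linExt_single]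
      congr 2
      refine hΦ fun S hS => ?_
      simp [rankOfNullity, hS, res]
  have htot : ∀ S T : c, S ≤ T ∨ T ≤ S := fun S T => hc.total S.2 T.2
  have hNU : F N = F U := by
    rw [hN, hU, map_orderSum _ _ (posMap c) F hFP, map_cycleSum _ _ (posMap c) F hFP]
    refine orderSum_eq_cycleSum _ _ (monotoneSubalgebra c) posMap_mem (fun i => ?_)
      (fun u hu v hv => posMap_rotaBaxter htot u hu v hv) I
    rw [hF]
    exact single_mem_monotoneSubalgebra (h := res (x i)) (fun S T hST => hx i hST) 1
  rw [hg, hg, hNU]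

theorem linExt_eq_of_mem_chainSpan {A B : Finset α} {N U : AddMonoidAlgebra ℚ (Finset α → ℤ)}
    (hNU : ∀ c : Set (Finset α), IsChain (· ⊆ ·) c → ∀ Φ : (Finset α → ℕ) → ℤ[X], DependsOn Φ c →
      linExt (fun f => (Φ (rankOfNullity f)).map (Int.castRingHom ℚ)) N
        = linExt (fun f => (Φ (rankOfNullity f)).map (Int.castRingHom ℚ)) U)
    {Φ : (Finset α → ℕ) → ℤ[X]} (hΦ : Φ ∈ chainSpan A B) :
    linExt (fun f => (Φ (rankOfNullity f)).map (Int.castRingHom ℚ)) N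
      = linExt (fun f => (Φ (rankOfNullity f)).map (Int.castRingHom ℚ)) U := by
  unfold chainSpan at hΦ
  induction hΦ using Submodule.span_induction with
  | mem Φ hΦ =>
    obtain ⟨c, hc, -, hΦ⟩ := hΦ
    exact hNU c hc Φ hΦ
  | zero =>
    have : ∀ u : AddMonoidAlgebra ℚ (Finset α → ℤ), linExt (fun f =>
        ((0 : (Finset α → ℕ) → ℤ[X]) (rankOfNullity f)).map (Int.castRingHom ℚ)) u = 0 := by
      intro u; simp [linExt, Finsupp.linearCombination_apply]
    rw [this, this]
  | add Φ Ψ _ _ h h' =>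
    have : ∀ u : AddMonoidAlgebra ℚ (Finset α → ℤ), linExt (fun f =>
        ((Φ + Ψ) (rankOfNullity f)).map (Int.castRingHom ℚ)) u
        = linExt (fun f => (Φ (rankOfNullity f)).map (Int.castRingHom ℚ)) u
          + linExt (fun f => (Ψ (rankOfNullity f)).map (Int.castRingHom ℚ)) u := by
      intro u
      simp [linExt, Finsupp.linearCombination_apply]
    rw [this, this, h, h']
  | smul r Φ _ h =>
    have : ∀ u : AddMonoidAlgebra ℚ (Finset α → ℤ), linExt (fun f =>
        ((r • Φ) (rankOfNullity f)).map (Int.castRingHom ℚ)) u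
        = r • linExt (fun f => (Φ (rankOfNullity f)).map (Int.castRingHom ℚ)) u := by
      intro u
      simp only [linExt, Finsupp.linearCombination_apply, LinearMap.coe_mk, AddHom.coe_mk,
        Pi.smul_apply, Finsupp.smul_sum]
      refine Finsupp.sum_congr fun f _ => ?_
      rw [smul_comm]
      congr 1
      simp
    rw [this, this, h]

/-- Spitzer's identity: functionals that are supported on chains of sets take the same value on
`orderSum` and `cycleSum`. -/
theorem linExt_orderSum_eq {A B : Finset α} {Φ : (Finset α → ℕ) → ℤ[X]} (hΦ : Φ ∈ chainSpan A B)
    (x : β → Finset α → ℤ) (hx : ∀ i, Monotone (x i)) (I : Finset β) :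
    linExt (fun f => (Φ (rankOfNullity f)).map (Int.castRingHom ℚ))
        (orderSum (posMap _) (fun i => AddMonoidAlgebra.single (x i) 1) I)
      = linExt (fun f => (Φ (rankOfNullity f)).map (Int.castRingHom ℚ))
        (cycleSum (posMap _) (fun i => AddMonoidAlgebra.single (x i) 1) I) :=
  linExt_eq_of_mem_chainSpan
    (fun _ hc _ hΦ => linExt_orderSum_eq_of_dependsOn hc hΦ x hx I) hΦ

end Transfer

/-! ### Weighted sums over partitions -/

section Partition

/-- The partition obtained by adding a part. -/
def consPartition {n m : ℕ} (h1 : 0 < m) (h2 : m ≤ n) (μ : (n - m).Partition) : n.Partition where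
  parts := m ::ₘ μ.parts
  parts_pos := by
    intro i hi
    rcases Multiset.mem_cons.1 hi with rfl | hi
    · exact h1
    · exact μ.parts_pos hi
  parts_sum := by rw [Multiset.sum_cons, μ.parts_sum]; omega

theorem zPart_eq_prod {n N : ℕ} (hN : n ≤ N) (l : n.Partition) :
    zPart l = ∏ i ∈ Icc 1 N, i ^ l.parts.count i * (l.parts.count i)! := by
  refine prod_subset (Icc_subset_Icc le_rfl hN) fun i _ hi => ?_
  have : i ∉ l.parts := by
    intro h
    have h1 := l.parts_pos h
    have h2 := l.le_of_mem_parts h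
    exact hi (mem_Icc.2 ⟨h1, h2⟩)
  simp [Multiset.count_eq_zero_of_notMem this]

theorem zPart_consPartition {n m : ℕ} (h1 : 0 < m) (h2 : m ≤ n) (μ : (n - m).Partition) :
    zPart (consPartition h1 h2 μ) = m * (μ.parts.count m + 1) * zPart μ := by
  rw [zPart_eq_prod (Nat.sub_le n m) μ, zPart]
  have hm : m ∈ Icc 1 n := mem_Icc.2 ⟨h1, h2⟩
  rw [← mul_prod_erase _ _ hm, ← mul_prod_erase _ _ hm]
  have : ∀ i ∈ (Icc 1 n).erase m, (consPartition h1 h2 μ).parts.count i = μ.parts.count i := by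
    intro i hi
    exact Multiset.count_cons_of_ne (ne_of_mem_erase hi) _
  rw [prod_congr rfl fun i hi => by rw [this i hi]]
  have hc : (consPartition h1 h2 μ).parts.count m = μ.parts.count m + 1 :=
    Multiset.count_cons_self _ _
  rw [hc, Nat.factorial_succ]
  ring

theorem zPart_pos {n : ℕ} (l : n.Partition) : 0 < zPart l := by
  refine prod_pos fun i hi => Nat.mul_pos (pow_pos (mem_Icc.1 hi).1 _) (Nat.factorial_pos _)

variable {R : Type*} [CommRing R] [Algebra ℚ R]

/-- The sum over all partitions of `n` of the products of the values of `p` on the parts, weighted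
by `1 / z_λ`. -/
noncomputable def partitionSum (p : ℕ → R) (n : ℕ) : R :=
  ∑ l : n.Partition, (1 / (zPart l : ℚ)) • (l.parts.map p).prod

/-- This is Newton's recursion between power sums and complete homogeneous functions. Write `n` as
the sum of `m * α_m` over the distinct parts `m` of `λ`; removing one part `m` from `λ` leaves `μ`
with `z_λ = m * α_m * z_μ`. -/
theorem smul_partitionSum (p : ℕ → R) (n : ℕ) :
    (n : ℚ) • partitionSum p n = ∑ m ∈ Icc 1 n, p m * partitionSum p (n - m) := by
  have hL : (n : ℚ) • partitionSum p n = ∑ l : n.Partition, ∑ m ∈ l.parts.toFinset,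
      (((m * l.parts.count m : ℕ) : ℚ) / zPart l) • (l.parts.map p).prod := by
    rw [partitionSum, smul_sum]
    refine sum_congr rfl fun l _ => ?_
    rw [← sum_smul, ← sum_div, ← Nat.cast_sum, smul_smul]
    have h := Finset.sum_multiset_count l.parts
    rw [l.parts_sum] at h
    have h' : ∑ m ∈ l.parts.toFinset, m * l.parts.count m = n := by
      rw [sum_congr rfl fun m _ => mul_comm m _]
      exact h.symm
    rw [h', mul_one_div]
  have hR : ∑ m ∈ Icc 1 n, p m * partitionSum p (n - m)
      = ∑ m ∈ Icc 1 n, ∑ μ : (n - m).Partition, (1 / (zPart μ : ℚ)) • (p m * (μ.parts.map p).prod) := by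
    refine sum_congr rfl fun m _ => ?_
    rw [partitionSum, mul_sum]
    exact sum_congr rfl fun μ _ => mul_smul_comm _ _ _
  rw [hL, hR, sum_sigma', sum_sigma']
  symm
  refine sum_bij (fun q hq => ⟨consPartition (mem_Icc.1 (mem_sigma.1 hq).1).1
    (mem_Icc.1 (mem_sigma.1 hq).1).2 q.2, q.1⟩) ?_ ?_ ?_ ?_
  · rintro ⟨m, μ⟩ hq
    simp [consPartition]
  · rintro ⟨m, μ⟩ hq ⟨m', μ'⟩ hq' h
    rw [Sigma.mk.injEq] at h
    obtain rfl : m = m' := eq_of_heq h.2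
    have h3 := congrArg Nat.Partition.parts h.1
    simp only [consPartition, Multiset.cons_inj_right] at h3
    rw [Nat.Partition.ext h3]
  · rintro ⟨l, m⟩ hq
    simp only [mem_sigma, mem_univ, Multiset.mem_toFinset, true_and] at hq
    have h1 := l.parts_pos hq
    have h2 := l.le_of_mem_parts hq
    refine ⟨⟨m, ⟨l.parts.erase m, fun {i} hi => l.parts_pos (Multiset.mem_of_mem_erase hi), ?_⟩⟩,
      by simpa using ⟨h1, h2⟩, ?_⟩
    · have := Multiset.sum_erase hq
      rw [l.parts_sum] at this
      omega
    · have h3 : consPartition h1 h2 ⟨l.parts.erase m, fun {i} hi =>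
          l.parts_pos (Multiset.mem_of_mem_erase hi), by
            have := Multiset.sum_erase hq
            rw [l.parts_sum] at this
            omega⟩ = l := Nat.Partition.ext (Multiset.cons_erase hq)
      rw [h3]
  · rintro ⟨m, μ⟩ hq
    have hm := mem_Icc.1 (mem_sigma.1 hq).1
    rw [zPart_consPartition hm.1 hm.2 μ]
    have hz : (zPart μ : ℚ) ≠ 0 := by exact_mod_cast (zPart_pos μ).ne'
    have hm0 : (m : ℚ) ≠ 0 := by exact_mod_cast (Nat.pos_iff_ne_zero.1 hm.1)
    have hc : (consPartition hm.1 hm.2 μ).parts.count m = μ.parts.count m + 1 :=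
      Multiset.count_cons_self _ _
    have hp : ((consPartition hm.1 hm.2 μ).parts.map p).prod = p m * (μ.parts.map p).prod := by
      simp [consPartition]
    simp only [hc, hp]
    congr 1
    push_cast
    have : (μ.parts.count m : ℚ) + 1 ≠ 0 := by positivity
    field_simp

theorem partitionSum_zero (p : ℕ → R) : partitionSum p 0 = 1 := by
  rw [partitionSum, Fintype.sum_unique]
  simp [zPart]

end Partition

/-! ### Evaluation of the sum over set partitions -/

section CycleSum

variable {α β : Type*} [Fintype α] [DecidableEq α] [DecidableEq β]

/-- The union of the blocks with index in `J`. -/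
def blocks (blk : α → β) (J : Finset β) : Finset α := univ.filter (blk · ∈ J)

/-- The Kazhdan–Lusztig polynomial of the uniform matroid of rank `m * b` on `m * c` elements. -/
noncomputable def uniformKL (c b m : ℕ) : ℤ[X] :=
  setKL (fun S : Finset (Fin (m * c)) => min S.card (m * b)) ∅ univ

omit [Fintype α] in
theorem setKL_min_card (E : Finset α) (N k : ℕ) (h : E.card = N) :
    setKL (fun S : Finset α => min S.card k) ∅ E
      = setKL (fun S : Finset (Fin N) => min S.card k) ∅ univ := by
  let e : Fin N ↪ α := ((Fin.castOrderIso h.symm).toEquiv.trans E.equivFin.symm).toEmbedding.trans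
    (Function.Embedding.subtype _)
  have hE : (univ : Finset (Fin N)).map e = E := by
    ext x
    simp only [mem_map, mem_univ, true_and]
    constructor
    · rintro ⟨i, rfl⟩
      simp [e]
    · intro hx
      refine ⟨Fin.cast h (E.equivFin ⟨x, hx⟩), ?_⟩
      simp [e]
  have := setKL_map e (fun S : Finset α => min S.card k) ∅ univ
  rw [hE, map_empty] at this
  rw [this]
  simp only [card_map]

theorem single_mul_single_one {G : Type*} [AddCommMonoid G] (g h : G) :
    AddMonoidAlgebra.single g (1 : ℚ) * AddMonoidAlgebra.single h 1
      = AddMonoidAlgebra.single (g + h) 1 := by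
  rw [AddMonoidAlgebra.single_mul_single, one_mul]

theorem prod_single_one {G ι : Type*} [AddCommMonoid G] (s : Finset ι) (g : ι → G) :
    ∏ i ∈ s, AddMonoidAlgebra.single (g i) (1 : ℚ) = AddMonoidAlgebra.single (∑ i ∈ s, g i) 1 := by
  classical
  induction s using Finset.induction_on with
  | empty => simp [AddMonoidAlgebra.one_def]
  | insert i s hi ih => rw [prod_insert hi, sum_insert hi, ih, single_mul_single_one]

/-- The functions of the form of a nullity function of a matroid whose elements outside the
union of the blocks with index in `K` are coloops. -/
def IsNullityOn (blk : α → β) (K : Finset β) (f : Finset α → ℤ) : Prop :=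
  f ∅ = 0 ∧ ∀ S T : Finset α, S ⊆ T → f S ≤ f T ∧
    f T - f S ≤ (T ∩ blocks blk K).card - (S ∩ blocks blk K).card

/-- The excess of the blocks with index in `J` over the capacity `b` of each of them. -/
def excess (blk : α → β) (b : ℕ) (J : Finset β) (S : Finset α) : ℤ :=
  (S ∩ blocks blk J).card - J.card * b

variable (blk : α → β)

omit [DecidableEq α] in
theorem disjoint_blocks {K J : Finset β} (h : Disjoint K J) :
    Disjoint (blocks blk K) (blocks blk J) := by
  rw [disjoint_left] at h ⊢
  intro x hx hx'
  simp only [blocks, mem_filter, mem_univ, true_and] at hx hx'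
  exact h hx hx'

theorem blocks_union (K J : Finset β) : blocks blk (K ∪ J) = blocks blk K ∪ blocks blk J := by
  ext x; simp [blocks]

theorem card_inter_blocks_union {K J : Finset β} (h : Disjoint K J) (S : Finset α) :
    (S ∩ blocks blk (K ∪ J)).card = (S ∩ blocks blk K).card + (S ∩ blocks blk J).card := by
  rw [blocks_union, inter_union_distrib_left, card_union_of_disjoint]
  exact (disjoint_blocks blk h).mono inter_subset_right inter_subset_right

theorem sum_excess_singleton (b : ℕ) (J : Finset β) :
    ∑ i ∈ J, excess blk b {i} = excess blk b J := by
  induction J using Finset.induction_on with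
  | empty => ext S; simp [excess, blocks]
  | insert i J hi ih =>
    rw [sum_insert hi, ih]
    ext S
    have := card_inter_blocks_union blk (disjoint_singleton_left.2 hi) S
    rw [← insert_eq] at this
    simp only [Pi.add_apply, excess, this, card_insert_of_notMem hi, card_singleton]
    push_cast
    ring

theorem monotone_excess (b : ℕ) (J : Finset β) : Monotone (excess blk b J) := by
  intro S T h
  have := card_le_card (inter_subset_inter_right (u := blocks blk J) h)
  simp only [excess]
  omega

theorem IsNullityOn.inter {K : Finset β} {f : Finset α → ℤ} (hf : IsNullityOn blk K f)
    (S : Finset α) : f (S ∩ blocks blk K) = f S := by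
  have := hf.2 (S ∩ blocks blk K) S inter_subset_left
  rw [inter_assoc, inter_self] at this
  omega

theorem IsNullityOn.eq_zero {K : Finset β} {f : Finset α → ℤ} (hf : IsNullityOn blk K f)
    {S : Finset α} (h : S ∩ blocks blk K = ∅) : f S = 0 := by
  rw [← hf.inter, h, hf.1]

theorem IsNullityOn.le_card {K : Finset β} {f : Finset α → ℤ} (hf : IsNullityOn blk K f)
    (S : Finset α) : 0 ≤ f S ∧ f S ≤ S.card := by
  have h1 := hf.2 ∅ S (empty_subset _)
  have h2 := card_le_card (inter_subset_left (s₁ := S) (s₂ := blocks blk K))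
  rw [hf.1, empty_inter, card_empty] at h1
  omega

theorem IsNullityOn.monotone_rank {K : Finset β} {f : Finset α → ℤ} (hf : IsNullityOn blk K f) :
    Monotone (rankOfNullity f) := by
  intro S T h
  have h1 := hf.2 S T h
  have h2 := card_sdiff_add_card_inter S (blocks blk K)
  have h3 := card_sdiff_add_card_inter T (blocks blk K)
  have h4 := card_le_card (sdiff_subset_sdiff h (Subset.refl (blocks blk K)))
  simp only [rankOfNullity]
  omega

theorem IsNullityOn.add {K J : Finset β} (h : Disjoint K J) {f g : Finset α → ℤ}
    (hf : IsNullityOn blk K f) (hg : IsNullityOn blk J g) : IsNullityOn blk (K ∪ J) (f + g) := by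
  refine ⟨by simp [hf.1, hg.1], fun S T hST => ?_⟩
  have h1 := hf.2 S T hST
  have h2 := hg.2 S T hST
  rw [card_inter_blocks_union blk h, card_inter_blocks_union blk h]
  simp only [Pi.add_apply]
  push_cast
  omega

theorem isNullityOn_excess (b : ℕ) (J : Finset β) :
    IsNullityOn blk J (fun S => max (excess blk b J S) 0) := by
  refine ⟨?_, fun S T hST => ?_⟩
  · simp only [excess, empty_inter, card_empty]
    have : (0 : ℤ) ≤ J.card * b := by positivity
    omega
  · have := card_le_card (inter_subset_inter_right (u := blocks blk J) hST)
    simp only [excess]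
    omega

/-- Adding nullity functions that live on disjoint families of blocks amounts to a direct sum, so
`setKL_union` applies. -/
theorem setKL_add_nullity {K J : Finset β} (h : Disjoint K J) {f g : Finset α → ℤ}
    (hf : IsNullityOn blk K f) (hg : IsNullityOn blk J g) :
    setKL (rankOfNullity (f + g)) ∅ (blocks blk (K ∪ J))
      = setKL (rankOfNullity f) ∅ (blocks blk K) * setKL (rankOfNullity g) ∅ (blocks blk J) := by
  have hd := disjoint_blocks blk h
  have hfJ : ∀ S ⊆ blocks blk J, f S = 0 := fun S hS => hf.eq_zero blk <|
    disjoint_iff_inter_eq_empty.1 (hd.symm.mono_left hS)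
  have hgK : ∀ S ⊆ blocks blk K, g S = 0 := fun S hS => hg.eq_zero blk <|
    disjoint_iff_inter_eq_empty.1 (hd.mono_left hS)
  rw [blocks_union, setKL_union (hf.add blk h hg).monotone_rank hd _ (empty_subset _), empty_inter,
    empty_inter]
  · congr 1 <;> refine setKL_congr fun S hS => ?_
    · simp [rankOfNullity, hgK S (mem_Icc.1 hS).2]
    · simp [rankOfNullity, hfJ S (mem_Icc.1 hS).2]
  · intro S hS
    have h1 : S.card = (S ∩ blocks blk K).card + (S ∩ blocks blk J).card := by
      rw [← card_inter_blocks_union blk h, blocks_union, inter_eq_left.2 hS]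
    have h2 := hf.le_card blk (S ∩ blocks blk K)
    have h3 := hg.le_card blk (S ∩ blocks blk J)
    have h4 := hfJ (S ∩ blocks blk J) inter_subset_right
    have h5 := hgK (S ∩ blocks blk K) inter_subset_right
    have h6 := hf.inter blk S
    have h7 := hg.inter blk S
    simp only [rankOfNullity, Pi.add_apply]
    omega

theorem card_blocks {c : ℕ} (hblk : ∀ i, (blocks blk {i}).card = c) (J : Finset β) :
    (blocks blk J).card = J.card * c := by
  induction J using Finset.induction_on with
  | empty => simp [blocks]
  | insert i J hi ih =>
    have := card_inter_blocks_union blk (disjoint_singleton_left.2 hi) univ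
    rw [← insert_eq] at this
    simp only [univ_inter] at this
    rw [this, ih, hblk, card_insert_of_notMem hi]
    ring

/-- Inside the blocks of `J` one has `|S| - (|S| - |J| * b)⁺ = min |S| (|J| * b)`, the rank in a
uniform matroid. -/
theorem setKL_excess {b c : ℕ} (hblk : ∀ i, (blocks blk {i}).card = c) (J : Finset β) :
    setKL (rankOfNullity fun S => max (excess blk b J S) 0) ∅ (blocks blk J)
      = uniformKL c b J.card := by
  rw [uniformKL, ← setKL_min_card (blocks blk J) _ _ (card_blocks blk hblk J)]
  refine setKL_congr fun S hS => ?_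
  rw [mem_Icc] at hS
  simp only [rankOfNullity, excess, inter_eq_left.2 hS.2]
  rw [← Nat.cast_mul]
  omega

-- There are `|I|.choose m` subsets of size `m`, each of weight `m! * (|I| - m)!`.
omit [DecidableEq β] in
theorem sum_powerset_factorial_smul {M : Type*} [AddCommGroup M] [Module ℚ M] (I : Finset β)
    (F : ℕ → M) :
    ∑ J ∈ I.powerset with J.Nonempty, ((J.card ! : ℚ) * ((I.card - J.card)! : ℚ)) • F J.card
      = ∑ m ∈ Icc 1 I.card, (I.card ! : ℚ) • F m := by
  have h1 := sum_powerset_apply_card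
    (fun m => if 1 ≤ m then ((m ! : ℚ) * ((I.card - m)! : ℚ)) • F m else 0) (x := I)
  have h2 : ∀ J : Finset β, J.Nonempty ↔ 1 ≤ J.card := fun J => card_pos.symm
  rw [sum_filter]
  simp only [h2]
  rw [h1]
  symm
  refine sum_subset_zero_on_sdiff (fun m hm => ?_) (fun m hm => ?_) (fun m hm => ?_)
  · rw [mem_range]; have := (mem_Icc.1 hm).2; omega
  · simp only [mem_sdiff, mem_range, mem_Icc] at hm
    rw [if_neg (by omega), smul_zero]
  · rw [mem_Icc] at hm
    rw [if_pos hm.1, ← Nat.cast_smul_eq_nsmul ℚ, smul_smul,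
      ← Nat.choose_mul_factorial_mul_factorial hm.2]
    push_cast
    rw [mul_assoc]

variable [Fintype β]

/-- The value of the Kazhdan–Lusztig functional on `cycleSum`. -/
theorem linExt_cycleSum {b c : ℕ} (hblk : ∀ i, (blocks blk {i}).card = c) (I : Finset β)
    (f : Finset α → ℤ) (hf : IsNullityOn blk Iᶜ f) :
    linExt (fun f => (setKL (rankOfNullity f) ∅ univ).map (Int.castRingHom ℚ))
      (AddMonoidAlgebra.single f 1 *
        cycleSum (posMap _) (fun i => AddMonoidAlgebra.single (excess blk b {i}) 1) I)
      = (I.card ! : ℚ) • (partitionSum (fun m => (uniformKL c b m).map (Int.castRingHom ℚ)) I.card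
        * (setKL (rankOfNullity f) ∅ (blocks blk Iᶜ)).map (Int.castRingHom ℚ)) := by
  induction I using Finset.strongInduction generalizing f with
  | H I ih =>
  rcases I.eq_empty_or_nonempty with rfl | hI
  · have : blocks blk (∅ᶜ : Finset β) = univ := by ext x; simp [blocks]
    rw [cycleSum_empty, mul_one, linExt_single, this]
    simp [partitionSum_zero]
  set p : ℕ → ℚ[X] := fun m => (uniformKL c b m).map (Int.castRingHom ℚ) with hp
  set Q := (setKL (rankOfNullity f) ∅ (blocks blk Iᶜ)).map (Int.castRingHom ℚ) with hQ
  rw [cycleSum_of_nonempty _ _ hI, mul_smul_comm, map_smul, mul_sum, map_sum]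
  -- The function `f` collects the blocks that are already split off. Multiplying by `P (∏ i ∈ J, x
  -- i)` adds the nullity of the uniform matroid on the blocks in `J`, so the induction hypothesis
  -- for `I \ J` applies to the sum and the polynomial of that uniform matroid factors out.
  have hterm : ∀ J ∈ I.powerset.filter (·.Nonempty),
      linExt (fun f => (setKL (rankOfNullity f) ∅ univ).map (Int.castRingHom ℚ))
        (AddMonoidAlgebra.single f 1 * (J.card ! : ℚ) • (posMap _ (∏ i ∈ J,
          AddMonoidAlgebra.single (excess blk b {i}) 1) * cycleSum (posMap _)
            (fun i => AddMonoidAlgebra.single (excess blk b {i}) 1) (I \ J)))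
      = ((J.card ! : ℚ) * ((I.card - J.card)! : ℚ)) •
        (p J.card * partitionSum p (I.card - J.card) * Q) := by
    intro J hJ
    rw [mem_filter, mem_powerset] at hJ
    have hdisj : Disjoint Iᶜ J := disjoint_compl_left.mono_right hJ.1
    have hcompl : (I \ J)ᶜ = Iᶜ ∪ J := by
      ext x; simp only [mem_compl, mem_sdiff, mem_union]; tauto
    have hg := isNullityOn_excess blk b J
    have hfg := hf.add blk hdisj hg
    rw [← hcompl] at hfg
    rw [prod_single_one, sum_excess_singleton, posMap_single, mul_smul_comm, map_smul, ← mul_assoc,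
      single_mul_single_one, ih _ (sdiff_ssubset hJ.1 hJ.2) _ hfg, hcompl,
      setKL_add_nullity blk hdisj hf hg, setKL_excess blk hblk, card_sdiff_of_subset hJ.1,
      Polynomial.map_mul, smul_smul]
    refine congrArg (fun q => ((J.card ! : ℚ) * ((I.card - J.card)! : ℚ)) • q) ?_
    simp only [hp, hQ]
    ring
  rw [sum_congr rfl hterm, sum_powerset_factorial_smul I fun m =>
    p m * partitionSum p (I.card - m) * Q]
  rw [← smul_sum, ← sum_mul, ← smul_partitionSum, smul_mul_assoc, smul_smul, smul_smul]
  refine congrArg (fun q : ℚ => q • _) ?_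
  have : (I.card : ℚ) ≠ 0 := by exact_mod_cast (card_pos.2 hI).ne'
  field_simp

end CycleSum

/-! ### Uniform matroids and direct sums of matroids -/

section Rank

theorem rk_eq_of {α : Type*} [Fintype α] (M : Matroid α) (S : Finset α) (r : ℕ)
    (h1 : ∃ I ⊆ S, M.Indep (I : Set α) ∧ I.card = r)
    (h2 : ∀ I ⊆ S, M.Indep (I : Set α) → I.card ≤ r) : rk M (S : Set α) = r := by
  have h : M.eRk (S : Set α) = r := by
    refine le_antisymm (Matroid.eRk_le_iff.2 fun I hI hind => ?_) (Matroid.le_eRk_iff.2 ?_)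
    · lift I to Finset α using Set.toFinite I
      rw [Set.encard_coe_eq_coe_finsetCard]
      exact_mod_cast h2 I (by exact_mod_cast hI) hind
    · obtain ⟨I, hI, hind, hc⟩ := h1
      exact ⟨I, by exact_mod_cast hI, hind, by rw [Set.encard_coe_eq_coe_finsetCard, hc]⟩
  rw [rk, h, ENat.toNat_natCast]

theorem uniformMatroid_indep_iff {k N : ℕ} (h : k ≤ N) (I : Finset (Fin N)) :
    (uniformMatroid k N h).Indep (I : Set (Fin N)) ↔ I.card ≤ k := by
  have hbase : ∀ B, (uniformMatroid k N h).IsBase B ↔ B.ncard = k := fun B => Iff.rfl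
  simp only [Matroid.indep_iff, hbase]
  constructor
  · rintro ⟨B, hB, hIB⟩
    rw [← hB, ← Set.ncard_coe_finset]
    exact Set.ncard_le_ncard hIB (Set.toFinite B)
  · intro hI
    obtain ⟨B, hIB, hB⟩ := exists_superset_card_eq hI (by simpa using h)
    exact ⟨B, by rw [Set.ncard_coe_finset, hB], by exact_mod_cast hIB⟩

theorem rk_uniformMatroid {k N : ℕ} (h : k ≤ N) (S : Finset (Fin N)) :
    rk (uniformMatroid k N h) (S : Set (Fin N)) = min S.card k := by
  refine rk_eq_of _ _ _ ?_ fun I hI hind => ?_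
  · obtain ⟨I, hI, hc⟩ := exists_subset_card_eq (min_le_left S.card k)
    exact ⟨I, hI, (uniformMatroid_indep_iff h I).2 (hc.trans_le (min_le_right _ _)), hc⟩
  · exact le_min (card_le_card hI) ((uniformMatroid_indep_iff h I).1 hind)

theorem uniformAB_loopless {b : ℕ} (hb : 1 ≤ b) (a m : ℕ) : (uniformAB a b m).Loopless := by
  rw [Matroid.loopless_iff_forall_isNonloop]
  intro e _
  rw [← Matroid.indep_singleton]
  have := (uniformMatroid_indep_iff (Nat.mul_le_mul_left m (Nat.le_add_left b a)) {e}).2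
  rw [coe_singleton, card_singleton] at this
  refine this ?_
  have he := e.pos
  rcases Nat.eq_zero_or_pos m with rfl | hm
  · rw [zero_mul] at he; omega
  · exact Nat.mul_pos hm hb

theorem klPoly_uniformAB {b : ℕ} (hb : 1 ≤ b) (a m : ℕ) :
    klPoly (uniformAB a b m) = uniformKL (a + b) b m := by
  rw [klPoly_eq_setKL _ (uniformAB_loopless hb a m) univ (by rw [coe_univ]; rfl), uniformKL]
  exact setKL_congr fun S _ => rk_uniformMatroid _ S

theorem rk_sigma {ι : Type*} [Fintype ι] {α : ι → Type*} [∀ i, Fintype (α i)]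
    (M : ∀ i, Matroid (α i)) (S : Set ((i : ι) × α i)) :
    rk (Matroid.sigma M) S = ∑ i, rk (M i) (Sigma.mk i ⁻¹' S) := by
  classical
  have h : ∀ i, ∃ I : Finset (α i), (M i).IsBasis' (I : Set (α i)) (Sigma.mk i ⁻¹' S) := by
    intro i
    obtain ⟨I, hI⟩ := (M i).exists_isBasis' (Sigma.mk i ⁻¹' S)
    exact ⟨I.toFinset, by simpa using hI⟩
  choose I hI using h
  have hpre : ∀ i, Sigma.mk i ⁻¹' ((univ.sigma I : Finset ((i : ι) × α i)) : Set ((i : ι) × α i))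
      = (I i : Set (α i)) := by
    intro i; ext x; simp
  have hB : (Matroid.sigma M).IsBasis' ((univ.sigma I : Finset ((i : ι) × α i)) : Set _) S := by
    rw [Matroid.isBasis'_iff_isBasis_inter_ground, Matroid.sigma_isBasis_iff]
    intro i
    rw [hpre]
    have := (hI i).isBasis_inter_ground
    convert this using 1
    ext x; simp
  have h1 : ∀ i, rk (M i) (Sigma.mk i ⁻¹' S) = (I i).card := by
    intro i
    rw [rk, (hI i).eRk_eq_encard, Set.encard_coe_eq_coe_finsetCard, ENat.toNat_natCast]
  rw [rk, hB.eRk_eq_encard, Set.encard_coe_eq_coe_finsetCard, ENat.toNat_natCast, card_sigma]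
  exact sum_congr rfl fun i _ => (h1 i).symm

theorem sigma_loopless {ι : Type*} {α : ι → Type*} (M : ∀ i, Matroid (α i))
    (h : ∀ i, (M i).Loopless) : (Matroid.sigma M).Loopless := by
  rw [Matroid.loopless_iff_forall_isNonloop]
  rintro ⟨i, x⟩ hx
  rw [← Matroid.indep_singleton, Matroid.sigma_indep_iff]
  intro j
  have := h j
  refine (M j).subsingleton_indep ?_ ?_
  · intro y hy z hz
    simp only [Set.mem_preimage, Set.mem_singleton_iff, Sigma.mk.injEq] at hy hz
    obtain ⟨rfl, hy⟩ := hy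
    rw [eq_of_heq hy, eq_of_heq hz.2]
  · intro y hy
    simp only [Set.mem_preimage, Set.mem_singleton_iff] at hy
    rw [← hy] at hx
    simpa using hx

/-- Kazhdan–Lusztig polynomials of matroids are multiplicative on direct sums. -/
theorem klPoly_sigma {ι : Type*} [Fintype ι] {α : ι → Type*} [∀ i, Fintype (α i)]
    (M : ∀ i, Matroid (α i)) (h : ∀ i, (M i).Loopless) (hE : ∀ i, (M i).E = Set.univ) :
    klPoly (Matroid.sigma M) = ∏ i, klPoly (M i) := by
  classical
  set ρ : Finset ((i : ι) × α i) → ℕ := fun S => rk (Matroid.sigma M) (S : Set ((i : ι) × α i))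
    with hρ
  let E : ι → Finset ((i : ι) × α i) := fun i => univ.map (Function.Embedding.sigmaMk i)
  have hmemE : ∀ i (p : (i : ι) × α i), p ∈ E i ↔ p.1 = i := by
    rintro i ⟨j, x⟩
    simp only [E, mem_map, mem_univ, true_and, Function.Embedding.sigmaMk_apply, Sigma.mk.injEq]
    constructor
    · rintro ⟨y, rfl, -⟩; rfl
    · rintro rfl; exact ⟨x, rfl, HEq.rfl⟩
  have hE' : (univ : Finset ((i : ι) × α i)) = univ.biUnion E := by
    ext p; simp [hmemE]
  have hempty : ∀ i, rk (M i) ∅ = 0 := fun i => rk_empty _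
  have hρi : ∀ i (S : Finset ((i : ι) × α i)), ρ (S ∩ E i)
      = rk (M i) (Sigma.mk i ⁻¹' (S : Set ((i : ι) × α i))) := by
    intro i S
    rw [hρ]
    simp only
    rw [rk_sigma, sum_eq_single i]
    · congr 1; ext x; simp [hmemE]
    · intro j _ hj
      rw [← hempty j]
      congr 1; ext x; simp [hmemE, hj]
    · simp
  rw [klPoly_eq_setKL _ (sigma_loopless M h) univ (by ext p; simp [hE]), hE',
    setKL_biUnion (ρ := ρ) (fun S T hST => rk_mono _ (by exact_mod_cast hST)) E]
  · refine prod_congr rfl fun i _ => ?_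
    have := setKL_map (Function.Embedding.sigmaMk i) ρ (∅ : Finset (α i)) univ
    rw [map_empty] at this
    rw [this, klPoly_eq_setKL _ (h i) univ (by rw [hE, coe_univ])]
    refine setKL_congr fun S _ => ?_
    have h1 : S.map (Function.Embedding.sigmaMk i) ∩ E i = S.map (Function.Embedding.sigmaMk i) :=
      inter_eq_left.2 (map_subset_map.2 (subset_univ _))
    rw [← h1, hρi]
    congr 1; ext x; simp
  · intro i j hij
    change Disjoint (E i) (E j)
    rw [disjoint_left]
    intro p hp hp'
    exact hij (((hmemE i p).1 hp).symm.trans ((hmemE j p).1 hp'))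
  · intro t _ S hS
    rw [hρ]
    simp only
    rw [rk_sigma]
    symm
    refine sum_subset_zero_on_sdiff (subset_univ t) (fun i hi => ?_) (fun i hi => ?_)
    · rw [← hempty i]
      congr 1
      ext x
      simp only [Set.mem_preimage, mem_coe, Set.mem_empty_iff_false, iff_false]
      intro hx
      obtain ⟨j, hj, hxj⟩ := mem_biUnion.1 (hS hx)
      have h3 := (hmemE j _).1 hxj
      subst h3
      exact (mem_sdiff.1 hi).2 hj
    · exact hρi i S

theorem klPoly_uniformSum {b : ℕ} (hb : 1 ≤ b) (a : ℕ) {n : ℕ} (l : n.Partition) :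
    klPoly (uniformSum a b l) = (l.parts.map fun i => klPoly (uniformAB a b i)).prod := by
  rw [uniformSum, klPoly_sigma _ (fun i => uniformAB_loopless hb a i.1) (fun i => rfl)]
  conv_rhs => rw [← Multiset.map_univ_coe l.parts, Multiset.map_map]
  rfl

end Rank

/-! ### Nested positive parts -/

section Nest

variable {β : Type*} {κ : Type*}

/-- The function `S ↦ (x i₁ + (x i₂ + ⋯)⁺)⁺` for the list `i₁, i₂, …`. -/
def nest (x : β → κ → ℤ) : List β → κ → ℤ
  | [] => 0
  | i :: l => fun S => max ((x i + nest x l) S) 0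

/-- Each of the `|I|!` orderings contributes `v`. The induction is over all `L` at once: fixing the
first index `i` replaces `L` by `u ↦ L (P (x i * u))` and `I` by `I.erase i`. -/
theorem map_orderSum_eq_of_forall_nest [DecidableEq β] {V : Type*} [AddCommGroup V] [Module ℚ V]
    (x : β → κ → ℤ) (I : Finset β) (L : AddMonoidAlgebra ℚ (κ → ℤ) →ₗ[ℚ] V) (v : V)
    (h : ∀ l : List β, l.Nodup → l.toFinset = I →
      L (AddMonoidAlgebra.single (nest x l) 1) = v) :
    L (orderSum (posMap κ) (fun i => AddMonoidAlgebra.single (x i) 1) I) = (I.card ! : ℚ) • v := by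
  induction I using Finset.strongInduction generalizing L with
  | H I ih =>
  rcases I.eq_empty_or_nonempty with rfl | hI
  · have := h [] List.nodup_nil rfl
    rw [orderSum_empty, ← this]
    simp [AddMonoidAlgebra.one_def, nest]
  rw [orderSum_of_nonempty _ _ hI, map_sum]
  have hterm : ∀ i ∈ I, L (posMap κ (AddMonoidAlgebra.single (x i) 1 * orderSum (posMap κ)
      (fun i => AddMonoidAlgebra.single (x i) 1) (I.erase i))) = ((I.card - 1)! : ℚ) • v := by
    intro i hi
    have := ih _ (erase_ssubset hi) (L ∘ₗ posMap κ ∘ₗ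
      LinearMap.mulLeft ℚ (AddMonoidAlgebra.single (x i) 1)) ?_
    · rw [card_erase_of_mem hi] at this
      exact this
    · intro l hl hlI
      have hil : i ∉ l := by
        intro hil
        have := List.mem_toFinset.2 hil
        rw [hlI] at this
        exact notMem_erase _ _ this
      rw [← h (i :: l) (List.nodup_cons.2 ⟨hil, hl⟩)
        (by rw [List.toFinset_cons, hlI, insert_erase hi])]
      simp only [LinearMap.coe_comp, Function.comp_apply, LinearMap.mulLeft_apply]
      rw [single_mul_single_one, posMap_single]
      rfl
  rw [sum_congr rfl hterm, sum_const, ← Nat.cast_smul_eq_nsmul ℚ, smul_smul,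
    ← Nat.mul_factorial_pred (card_pos.2 hI).ne', Nat.cast_mul]

theorem nest_nonneg (x : β → κ → ℤ) (l : List β) (S : κ) : 0 ≤ nest x l S := by
  cases l with
  | nil => exact le_rfl
  | cons i l => exact le_max_right _ _

/-- Together with `exists_sum_take_eq_nest`, this says that a nested positive part is the maximum of
the prefix sums, the empty prefix included. -/
theorem sum_take_le_nest (x : β → κ → ℤ) (l : List β) (S : κ) (k : ℕ) :
    ((l.take k).map (x · S)).sum ≤ nest x l S := by
  induction l generalizing k with
  | nil => simp [nest]
  | cons i l ih =>
    cases k with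
    | zero => simpa using nest_nonneg x (i :: l) S
    | succ k =>
      rw [List.take_succ_cons, List.map_cons, List.sum_cons]
      exact (add_le_add_right (ih k) _).trans (le_max_left _ _)

theorem exists_sum_take_eq_nest (x : β → κ → ℤ) (l : List β) (S : κ) :
    ∃ k ≤ l.length, ((l.take k).map (x · S)).sum = nest x l S := by
  induction l with
  | nil => exact ⟨0, le_rfl, rfl⟩
  | cons i l ih =>
    obtain ⟨k, hk, h⟩ := ih
    rcases le_total ((x i + nest x l) S) 0 with h0 | h0
    · exact ⟨0, Nat.zero_le _, (max_eq_right h0).symm⟩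
    · refine ⟨k + 1, Nat.succ_le_succ hk, ?_⟩
      rw [List.take_succ_cons, List.map_cons, List.sum_cons, h]
      exact (max_eq_left h0).symm

theorem nest_map {β' κ' : Type*} (x : β → κ → ℤ) (x' : β' → κ' → ℤ) (σ : β' → β) (S : κ) (S' : κ')
    (h : ∀ i, x (σ i) S = x' i S') (l : List β') : nest x (l.map σ) S = nest x' l S' := by
  induction l with
  | nil => rfl
  | cons i l ih =>
    simp only [List.map_cons, nest, Pi.add_apply, h, ih]

end Nest

/-! ### Sets with bounded intersections along a chain -/

section Capacity

variable {α : Type*} [DecidableEq α] {T : ℕ → Finset α} {w : ℕ → ℕ} {n : ℕ}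

/-- A set contains a subset that satisfies the capacity bounds given by `w` and omits as few
elements as the excess requires. -/
theorem exists_subset_of_excess (hT : Monotone T) (d : Finset α → ℤ)
    (hle : ∀ S, ∀ k ≤ n, ((S ∩ T k).card : ℤ) - w k ≤ d S)
    (hex : ∀ S, ∃ k ≤ n, ((S ∩ T k).card : ℤ) - w k = d S) (S : Finset α) (hd : 0 ≤ d S)
    : ∃ I ⊆ S, d I ≤ 0 ∧ (I.card : ℤ) = S.card - d S := by
  classical
  obtain ⟨e, he⟩ := Int.eq_ofNat_of_zero_le hd
  induction e generalizing S with
  | zero => exact ⟨S, Subset.rfl, by simp [he], by simp [he]⟩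
  | succ e ih =>
    have hP : ∃ k, k ≤ n ∧ ((S ∩ T k).card : ℤ) - w k = d S := hex S
    set k := Nat.find hP with hk
    obtain ⟨hkn, hkd⟩ := Nat.find_spec hP
    rw [← hk] at hkn hkd
    have hpos : 0 < (S ∩ T k).card := by
      have : (0 : ℤ) ≤ w k := by positivity
      push_cast at he
      omega
    obtain ⟨x, hx⟩ := card_pos.1 hpos
    rw [mem_inter] at hx
    have hcard : ∀ j, x ∈ T j → ((S.erase x ∩ T j).card : ℤ) = (S ∩ T j).card - 1 := by
      intro j hj
      rw [erase_inter, card_erase_of_mem (mem_inter.2 ⟨hx.1, hj⟩), Nat.cast_sub]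
      · simp
      · exact card_pos.2 ⟨x, mem_inter.2 ⟨hx.1, hj⟩⟩
    have hd' : d (S.erase x) = d S - 1 := by
      apply le_antisymm
      · obtain ⟨j, hj, hjd⟩ := hex (S.erase x)
        have h1 := hle S j hj
        by_cases hjS : ((S ∩ T j).card : ℤ) - w j = d S
        · have hkj : k ≤ j := Nat.find_min' hP ⟨hj, hjS⟩
          have := hcard j (hT hkj hx.2)
          omega
        · have := card_le_card (inter_subset_inter_right (u := T j) (erase_subset x S))
          omega
      · have h1 := hle (S.erase x) k hkn
        have := hcard k hx.2
        omega
    have hde : d (S.erase x) = e := by rw [hd', he]; push_cast; ring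
    obtain ⟨I, hI, hI0, hIc⟩ := ih (S.erase x) (by omega) hde
    refine ⟨I, hI.trans (erase_subset _ _), hI0, ?_⟩
    rw [hIc, hd', card_erase_of_mem hx.1, Nat.cast_sub (card_pos.2 ⟨x, hx.1⟩)]
    push_cast
    ring

/-- A set that satisfies the capacity bounds can be extended to one that attains the last one. -/
theorem exists_superset_of_capacity (hT : Monotone T) {b : ℕ} (h0 : T 0 = ∅)
    (hn : ∀ x, x ∈ T n) (hb : ∀ k < n, b ≤ (T (k + 1) \ T k).card) (I : Finset α)
    (hI : ∀ k ≤ n, (I ∩ T k).card ≤ k * b) :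
    ∃ J, I ⊆ J ∧ (∀ k ≤ n, (J ∩ T k).card ≤ k * b) ∧ J.card = n * b := by
  classical
  have hIn : ∀ I : Finset α, I ∩ T n = I := fun I => inter_eq_left.2 fun x _ => hn x
  induction he : n * b - I.card generalizing I with
  | zero =>
    refine ⟨I, Subset.rfl, hI, ?_⟩
    have := hI n le_rfl
    rw [hIn] at this
    omega
  | succ e ih =>
    -- Let `k` be the largest tight index; `k < n` because `I` is too small. The layer `T (k + 1) \
    -- T k` contains fewer than `b` elements of `I`, hence has an element to spare. Adding it
    -- affects only the indices beyond `k`, none of which is tight.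
    set s := (range (n + 1)).filter (fun k => (I ∩ T k).card = k * b) with hs
    have hne : s.Nonempty := ⟨0, by simp [hs, h0]⟩
    set k := s.max' hne with hk
    have hks : k ∈ s := max'_mem _ _
    simp only [hs, mem_filter, mem_range] at hks
    have hkmax : ∀ j ≤ n, k < j → (I ∩ T j).card < j * b := by
      intro j hj hkj
      refine lt_of_le_of_ne (hI j hj) fun h => ?_
      have : j ∈ s := by simp only [hs, mem_filter, mem_range]; exact ⟨by omega, h⟩
      exact absurd (le_max' s j this) (by omega)
    have hkn : k < n := by
      rcases Nat.lt_or_ge k n with h | h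
      · exact h
      · have hkn : k = n := by omega
        have h2 := hks.2
        rw [hkn, hIn] at h2
        omega
    have h1 := hkmax (k + 1) hkn (Nat.lt_succ_self k)
    have hlt : (I ∩ (T (k + 1) \ T k)).card < (T (k + 1) \ T k).card := by
      have h2 : I ∩ (T (k + 1) \ T k) = (I ∩ T (k + 1)) \ (I ∩ T k) := by
        ext x; simp only [mem_inter, mem_sdiff]; tauto
      have h3 := card_sdiff_of_subset (inter_subset_inter_left (s := I) (hT (Nat.le_succ k)))
      have h4 := hb k hkn
      rw [h2]
      rw [Nat.succ_eq_add_one] at h3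
      have h6 := card_le_card (inter_subset_inter_left (s := I) (hT (Nat.le_succ k)))
      rw [Nat.succ_eq_add_one, hks.2] at h6
      rw [h3, hks.2]
      rw [add_mul, one_mul] at h1
      omega
    obtain ⟨x, hx, hxI⟩ : ∃ x ∈ T (k + 1) \ T k, x ∉ I := by
      by_contra! hcon
      rw [inter_eq_right.2 hcon] at hlt
      exact lt_irrefl _ hlt
    rw [mem_sdiff] at hx
    have hstep : ∀ j ≤ n, (insert x I ∩ T j).card ≤ j * b := by
      intro j hj
      rcases Nat.lt_or_ge k j with hkj | hkj
      · have := hkmax j hj hkj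
        have h5 : insert x I ∩ T j ⊆ insert x (I ∩ T j) := by
          intro y; simp only [mem_inter, mem_insert]; tauto
        have := card_le_card h5
        have := card_insert_le x (I ∩ T j)
        omega
      · rw [insert_inter_of_notMem fun h => hx.2 (hT hkj h)]
        exact hI j hj
    obtain ⟨J, hJ1, hJ2, hJ3⟩ := ih (insert x I) hstep (by rw [card_insert_of_notMem hxI]; omega)
    exact ⟨J, (subset_insert _ _).trans hJ1, hJ2, hJ3⟩

end Capacity

/-! ### Rank function of the Catalan matroid -/

section Catalan

theorem count_mod_le (a b q s : ℕ) (hs : s ≤ a + b) :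
    Nat.count (fun x => a ≤ x % (a + b)) (q * (a + b) + s) = q * b + (s - a) := by
  have h1 : ∀ q s, s ≤ a + b → Nat.count (fun k => a ≤ (q * (a + b) + k) % (a + b)) s = s - a := by
    intro q s
    induction s with
    | zero => simp
    | succ s ih =>
      intro hs
      rw [Nat.count_succ, ih (by omega), Nat.mul_add_mod_self_right, Nat.mod_eq_of_lt (by omega)]
      split_ifs <;> omega
  have h2 : ∀ q, Nat.count (fun x => a ≤ x % (a + b)) (q * (a + b)) = q * b := by
    intro q
    induction q with
    | zero => simp
    | succ q ih =>
      rw [add_mul, one_mul, Nat.count_add, ih, h1 q _ le_rfl, add_mul]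
      omega
  rw [Nat.count_add, h2, h1 q s hs]

theorem card_filter_val_lt {N : ℕ} (p : ℕ → Prop) [DecidablePred p] {m : ℕ} (hm : m ≤ N) :
    (univ.filter fun x : Fin N => (x : ℕ) < m ∧ p x).card = Nat.count p m := by
  rw [Nat.count_eq_card_filter_range, ← card_map Fin.valEmbedding]
  congr 1
  ext y
  simp only [mem_map, mem_filter, mem_univ, true_and, Fin.valEmbedding_apply, mem_range]
  constructor
  · rintro ⟨x, hx, rfl⟩; exact hx
  · rintro ⟨h1, h2⟩; exact ⟨⟨y, by omega⟩, ⟨h1, h2⟩, rfl⟩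

variable {a b n : ℕ}

/-- The union of the last `k` blocks. -/
def lastBlocks (n c k : ℕ) : Finset (Fin (n * c)) := univ.filter fun x => (n - k) * c ≤ (x : ℕ)

theorem card_inter_lastBlocks (n c k : ℕ) (T : Finset (Fin (n * c))) :
    (T ∩ lastBlocks n c k).card + (T.filter fun x : Fin _ => (x : ℕ) < (n - k) * c).card = T.card := by
  rw [← card_filter_add_card_filter_not (s := T) (fun x : Fin _ => (n - k) * c ≤ (x : ℕ))]
  congr 2
  · ext x; simp [lastBlocks]
  · ext x; simp

theorem card_catalanSet_filter {q s : ℕ} (hs : s ≤ a + b) (h : q * (a + b) + s ≤ n * (a + b)) :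
    ((catalanSet a b n).filter fun x : Fin _ => (x : ℕ) < q * (a + b) + s).card = q * b + (s - a) := by
  rw [← count_mod_le a b q s hs, ← card_filter_val_lt (N := n * (a + b)) _ h, catalanSet,
    filter_filter]
  congr 1
  ext x; simp [and_comm]

theorem card_catalanSet : (catalanSet a b n).card = n * b := by
  have := card_catalanSet_filter (a := a) (b := b) (n := n) (q := n) (s := 0) (Nat.zero_le _) le_rfl
  rw [filter_true_of_mem fun x _ => by simp] at this
  simpa using this

/-- The bases of the Catalan matroid in terms of the numbers of elements in the last blocks. -/
theorem setLE_catalanSet_iff (ha : 1 ≤ a + b) (T : Finset (Fin (n * (a + b)))) :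
    SetLE T (catalanSet a b n) ↔
      T.card = n * b ∧ ∀ k ≤ n, (T ∩ lastBlocks n (a + b) k).card ≤ k * b := by
  rw [setLE_iff, card_catalanSet]
  refine and_congr_right fun hT => ⟨fun h k hk => ?_, fun h j => ?_⟩
  · have h1 := card_inter_lastBlocks n (a + b) k T
    -- For `k < n` the comparison is used at the last position before the final `k` blocks, which is
    -- `(n - k) * (a + b) - 1`. For `k = n` there is no such position, but the cardinality of `T`
    -- suffices.
    rcases hk.eq_or_lt with rfl | hk
    · omega
    have hpos : 1 ≤ (n - k) * (a + b) := Nat.mul_pos (by omega) ha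
    have hle : (n - k) * (a + b) ≤ n * (a + b) := Nat.mul_le_mul_right _ (Nat.sub_le _ _)
    have h2 := h ⟨(n - k) * (a + b) - 1, by omega⟩
    have h3 : ∀ S : Finset (Fin (n * (a + b))), S.filter (· ≤ ⟨(n - k) * (a + b) - 1, by omega⟩)
        = S.filter fun x : Fin _ => (x : ℕ) < (n - k) * (a + b) := by
      intro S
      refine filter_congr fun x _ => ?_
      rw [Fin.le_def]
      simp only
      omega
    have h4 := card_catalanSet_filter (a := a) (b := b) (n := n) (q := n - k) (s := 0)
      (Nat.zero_le _) (by simpa using hle)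
    simp only [add_zero, Nat.zero_sub] at h4
    rw [h3, h3, h4, Nat.sub_mul] at h2
    have : k * b ≤ n * b := Nat.mul_le_mul_right _ hk.le
    omega
  · obtain ⟨j, hj⟩ := j
    obtain ⟨q, r, rfl, hrc, hqn⟩ : ∃ q r, j = q * (a + b) + r ∧ r < a + b ∧ q < n :=
      ⟨j / (a + b), j % (a + b), (Nat.div_add_mod' _ _).symm, Nat.mod_lt _ ha,
        (Nat.div_lt_iff_lt_mul ha).2 hj⟩
    have hqc : (q + 1) * (a + b) = q * (a + b) + (a + b) := Nat.succ_mul _ _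
    have hqc' : (q + 1) * (a + b) ≤ n * (a + b) := Nat.mul_le_mul_right _ hqn
    have h3 : ∀ S : Finset (Fin (n * (a + b))), S.filter (· ≤ ⟨q * (a + b) + r, hj⟩)
        = S.filter fun x : Fin _ => (x : ℕ) < q * (a + b) + (r + 1) := by
      intro S
      refine filter_congr fun x _ => ?_
      rw [Fin.le_def]
      simp only
      omega
    rw [h3, h3, card_catalanSet_filter (by omega) (by omega)]
    have h5 := card_inter_lastBlocks n (a + b) (n - q) T
    have h6 := h (n - q) (Nat.sub_le _ _)
    have h7 := card_inter_lastBlocks n (a + b) (n - q - 1) T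
    have h8 := h (n - q - 1) (by omega)
    rw [show n - (n - q) = q by omega] at h5
    rw [show n - (n - q - 1) = q + 1 by omega] at h7
    -- Inside block `q` the bound needed is `q * b + (r + 1 - a)`, with truncated subtraction. While
    -- it equals `q * b`, the bound at the start of the block suffices (`h9`); after that, use the
    -- bound at its end minus the `a + b - (r + 1)` remaining positions (`h10`).
    have h9 : (T.filter fun x : Fin _ => (x : ℕ) < q * (a + b)).card
        ≤ (T.filter fun x : Fin _ => (x : ℕ) < q * (a + b) + (r + 1)).card :=
      card_le_card (monotone_filter_right T fun x hx => by omega)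
    have h10 : (T.filter fun x : Fin _ => (x : ℕ) < (q + 1) * (a + b)).card
        ≤ (T.filter fun x : Fin _ => (x : ℕ) < q * (a + b) + (r + 1)).card + (a + b - (r + 1)) := by
      have hsub : (T.filter fun x : Fin _ => (x : ℕ) < (q + 1) * (a + b))
          ⊆ (T.filter fun x : Fin _ => (x : ℕ) < q * (a + b) + (r + 1)) ∪
            univ.filter fun x : Fin (n * (a + b)) => q * (a + b) + (r + 1) ≤ x ∧ (x : ℕ) < (q + 1) * (a + b) := by
        intro x hx
        simp only [mem_union, mem_filter, mem_univ, true_and] at hx ⊢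
        by_cases hlt : (x : ℕ) < q * (a + b) + (r + 1)
        · exact .inl ⟨hx.1, hlt⟩
        · exact .inr ⟨by omega, hx.2⟩
      refine (card_le_card hsub).trans ((card_union_le _ _).trans ?_)
      refine Nat.add_le_add_left ?_ _
      rw [← card_map Fin.valEmbedding]
      have : (univ.filter fun x : Fin (n * (a + b)) => q * (a + b) + (r + 1) ≤ x ∧ (x : ℕ) < (q + 1) * (a + b)).map
          Fin.valEmbedding ⊆ Ico (q * (a + b) + (r + 1)) ((q + 1) * (a + b)) := by
        intro y hy
        simp only [mem_map, mem_filter, mem_univ, true_and, Fin.valEmbedding_apply] at hy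
        obtain ⟨x, hx, rfl⟩ := hy
        exact mem_Ico.2 hx
      refine (card_le_card this).trans ?_
      rw [Nat.card_Ico]
      omega
    have e1 : (n - q) * b + q * b = n * b := by rw [← add_mul]; congr 1; omega
    have e2 : (n - q - 1) * b + q * b + b = n * b := by
      rw [← add_mul, ← Nat.succ_mul]; congr 1; omega
    omega

theorem lastBlocks_mono (n c : ℕ) : Monotone (lastBlocks n c) := by
  intro k k' h x hx
  simp only [lastBlocks, mem_filter, mem_univ, true_and] at hx ⊢
  exact (Nat.mul_le_mul_right c (by omega)).trans hx

theorem card_lastBlocks_sdiff (n c : ℕ) {k : ℕ} (hk : k < n) :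
    (lastBlocks n c (k + 1) \ lastBlocks n c k).card = c := by
  have h : (n - k) * c = (n - (k + 1)) * c + c := by rw [← Nat.succ_mul]; congr 1; omega
  have h2 : (n - k) * c ≤ n * c := Nat.mul_le_mul_right _ (Nat.sub_le _ _)
  rw [← card_map Fin.valEmbedding]
  have : (lastBlocks n c (k + 1) \ lastBlocks n c k).map Fin.valEmbedding
      = Ico ((n - (k + 1)) * c) ((n - k) * c) := by
    ext y
    simp only [lastBlocks, mem_map, mem_sdiff, mem_filter, mem_univ, true_and,
      Fin.valEmbedding_apply, mem_Ico]
    constructor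
    · rintro ⟨x, hx, rfl⟩; omega
    · rintro hy; exact ⟨⟨y, by omega⟩, by simpa using hy, rfl⟩
  rw [this, Nat.card_Ico]
  omega

theorem catalanMatroid_indep_iff (ha : 1 ≤ a + b) (I : Finset (Fin (n * (a + b)))) :
    (catalanMatroid a b n).Indep (I : Set _) ↔
      ∀ k ≤ n, (I ∩ lastBlocks n (a + b) k).card ≤ k * b := by
  have hbase : ∀ B, (catalanMatroid a b n).IsBase B ↔
      ∃ T : Finset (Fin (n * (a + b))), (T : Set _) = B ∧ SetLE T (catalanSet a b n) :=
    fun B => Iff.rfl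
  simp only [Matroid.indep_iff, hbase, setLE_catalanSet_iff ha]
  constructor
  · rintro ⟨B, ⟨T, rfl, hT⟩, hI⟩ k hk
    exact (card_le_card (inter_subset_inter_right (by exact_mod_cast hI))).trans (hT.2 k hk)
  · intro hI
    obtain ⟨J, hIJ, hJ, hc⟩ := exists_superset_of_capacity (lastBlocks_mono n (a + b)) (n := n)
      (by ext x; simp [lastBlocks]) (fun x => by simp [lastBlocks])
      (fun k hk => by rw [card_lastBlocks_sdiff n (a + b) hk]; omega) I hI
    exact ⟨J, ⟨J, rfl, hc, hJ⟩, by exact_mod_cast hIJ⟩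

theorem catalanMatroid_loopless (hb : 1 ≤ b) : (catalanMatroid a b n).Loopless := by
  rw [Matroid.loopless_iff_forall_isNonloop]
  intro e _
  rw [← Matroid.indep_singleton, ← coe_singleton, catalanMatroid_indep_iff (by omega)]
  intro k hk
  rcases Nat.eq_zero_or_pos k with rfl | hk0
  · simp [lastBlocks]
  · refine (card_le_card inter_subset_left).trans ?_
    rw [card_singleton]
    exact Nat.mul_pos hk0 hb

/-- The rank function of the Catalan matroid. -/
theorem rk_catalanMatroid (ha : 1 ≤ a + b) (d : Finset (Fin (n * (a + b))) → ℤ)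
    (hle : ∀ S, ∀ k ≤ n, ((S ∩ lastBlocks n (a + b) k).card : ℤ) - k * b ≤ d S)
    (hex : ∀ S, ∃ k ≤ n, ((S ∩ lastBlocks n (a + b) k).card : ℤ) - k * b = d S)
    (S : Finset (Fin (n * (a + b)))) :
    rk (catalanMatroid a b n) (S : Set _) = rankOfNullity d S := by
  have hd0 : 0 ≤ d S := by
    have := hle S 0 (Nat.zero_le _)
    simp only [Nat.cast_zero, zero_mul, sub_zero] at this
    omega
  refine rk_eq_of _ _ _ ?_ fun I hI hind => ?_
  · obtain ⟨I, hI, hI0, hc⟩ := exists_subset_of_excess (w := fun k => k * b) (n := n)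
      (lastBlocks_mono n (a + b)) d (by simpa using hle) (by simpa using hex) S hd0
    refine ⟨I, hI, (catalanMatroid_indep_iff ha I).2 fun k hk => ?_, ?_⟩
    · have := hle I k hk
      rw [← Nat.cast_mul] at this
      omega
    · simp only [rankOfNullity]; omega
  · rw [catalanMatroid_indep_iff ha] at hind
    -- At a maximising `k`, an independent `I ⊆ S` has at most `k * b` elements in the last `k`
    -- blocks and at most those of `S` elsewhere, which totals `|S| - d S`.
    obtain ⟨k, hk, hkd⟩ := hex S
    have h1 := hind k hk
    have h2 := card_sdiff_add_card_inter I (lastBlocks n (a + b) k)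
    have h3 := card_sdiff_add_card_inter S (lastBlocks n (a + b) k)
    have h4 := card_le_card (sdiff_subset_sdiff hI (Subset.refl (lastBlocks n (a + b) k)))
    rw [← Nat.cast_mul] at hkd
    simp only [rankOfNullity]
    omega

end Catalan

/-! ### Symmetry in the blocks and conclusion -/

section Main

variable {n c : ℕ}

theorem card_blocks_divNat (i : Fin n) :
    (blocks (Fin.divNat : Fin (n * c) → Fin n) {i}).card = c := by
  have h : blocks (Fin.divNat : Fin (n * c) → Fin n) {i}
      = univ.map ((Function.Embedding.sectR i (Fin c)).trans
        (finProdFinEquiv (m := n) (n := c)).toEmbedding) := by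
    ext x
    simp only [blocks, mem_filter, mem_univ, true_and, mem_singleton, mem_map]
    constructor
    · rintro rfl
      exact ⟨x.modNat, (finProdFinEquiv (m := n) (n := c)).right_inv x⟩
    · rintro ⟨j, rfl⟩
      exact congrArg Prod.fst ((finProdFinEquiv (m := n) (n := c)).left_inv (i, j))
  rw [h, card_map, card_univ, Fintype.card_fin]

/-- The permutation of the ground set induced by a permutation of the blocks. -/
def blockPerm (c : ℕ) (σ : Equiv.Perm (Fin n)) : Equiv.Perm (Fin (n * c)) :=
  finProdFinEquiv.symm.trans ((Equiv.prodCongr σ (Equiv.refl (Fin c))).trans finProdFinEquiv)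

theorem divNat_blockPerm (σ : Equiv.Perm (Fin n)) (x : Fin (n * c)) :
    (blockPerm c σ x).divNat = σ x.divNat :=
  congrArg Prod.fst ((finProdFinEquiv (m := n) (n := c)).left_inv (σ x.divNat, x.modNat))

theorem excess_blockPerm (b : ℕ) (σ : Equiv.Perm (Fin n)) (i : Fin n) (S : Finset (Fin (n * c))) :
    excess Fin.divNat b {σ i} (S.map (blockPerm c σ).toEmbedding)
      = excess Fin.divNat b {i} S := by
  have h : S.map (blockPerm c σ).toEmbedding ∩ blocks Fin.divNat {σ i}
      = (S ∩ blocks Fin.divNat {i}).map (blockPerm c σ).toEmbedding := by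
    ext y
    obtain ⟨x, rfl⟩ := (blockPerm c σ).surjective y
    simp [blocks, divNat_blockPerm]
  rw [excess, excess, h, card_map, card_singleton, card_singleton]

/-- Permuting the blocks is a bijection of the ground set that carries one nullity function to the
other, so the order in which the blocks are nested does not matter. -/
theorem setKL_nest_map (b : ℕ) (σ : Equiv.Perm (Fin n)) (l : List (Fin n)) :
    setKL (rankOfNullity (nest (fun i => excess (Fin.divNat : Fin (n * c) → Fin n) b {i})
        (l.map σ))) ∅ univ
      = setKL (rankOfNullity (nest (fun i => excess (Fin.divNat : Fin (n * c) → Fin n) b {i})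
        l)) ∅ univ := by
  have h := setKL_map (blockPerm c σ).toEmbedding (rankOfNullity (nest
    (fun i => excess (Fin.divNat : Fin (n * c) → Fin n) b {i}) (l.map σ))) ∅ univ
  rw [map_empty, map_univ_equiv] at h
  rw [h]
  refine setKL_congr fun S _ => ?_
  rw [rankOfNullity, rankOfNullity, card_map,
    nest_map _ (fun i => excess (Fin.divNat : Fin (n * c) → Fin n) b {i}) σ _ S
      fun i => excess_blockPerm b σ i S]

theorem exists_perm_of_nodup {l l' : List (Fin n)} (hl : l.Nodup) (hl' : l'.Nodup)
    (h : ∀ i, i ∈ l) (h' : ∀ i, i ∈ l') : ∃ σ : Equiv.Perm (Fin n), l = l'.map σ := by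
  let e := hl.getEquivOfForallMemList l h
  let e' := hl'.getEquivOfForallMemList l' h'
  have hlen : l'.length = l.length := by
    have h1 := Fintype.card_congr e
    have h2 := Fintype.card_congr e'
    simp only [Fintype.card_fin] at h1 h2
    rw [h1, h2]
  refine ⟨e'.symm.trans ((finCongr hlen).trans e), ?_⟩
  refine List.ext_getElem (by simp [hlen]) fun i h1 h2 => ?_
  have h3 : i < l'.length := by rw [hlen]; exact h1
  have h4 : e'.symm l'[i] = ⟨i, h3⟩ := by
    rw [Equiv.symm_apply_eq]; rfl
  rw [List.getElem_map]
  simp only [Equiv.trans_apply, h4]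
  rfl

theorem mem_take_ofFn_rev {k : ℕ} (hk : k ≤ n) (i : Fin n) :
    i ∈ (List.ofFn fun j : Fin n => j.rev).take k ↔ n - k ≤ i := by
  rw [List.mem_take_iff_getElem]
  simp only [List.length_ofFn, List.getElem_ofFn]
  constructor
  · rintro ⟨j, hj, rfl⟩
    simp only [Fin.val_rev]
    omega
  · intro h
    refine ⟨n - 1 - i, by omega, ?_⟩
    ext
    simp only [Fin.val_rev]
    omega

theorem nodup_ofFn_rev : (List.ofFn fun j : Fin n => j.rev).Nodup :=
  List.nodup_ofFn.2 Fin.rev_injective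

theorem sum_take_ofFn_rev (b : ℕ) {k : ℕ} (hk : k ≤ n) (S : Finset (Fin (n * c))) :
    (((List.ofFn fun j : Fin n => j.rev).take k).map
        (fun i => excess Fin.divNat b {i} S)).sum
      = ((S ∩ lastBlocks n c k).card : ℤ) - k * b := by
  have hnd : ((List.ofFn fun j : Fin n => j.rev).take k).Nodup :=
    nodup_ofFn_rev.sublist (List.take_sublist _ _)
  rw [← List.sum_toFinset _ hnd, ← Finset.sum_apply S _ (fun i => excess Fin.divNat b {i}),
    sum_excess_singleton, excess, List.toFinset_card_of_nodup hnd, List.length_take,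
    List.length_ofFn, min_eq_left hk]
  congr 4
  ext x
  rw [blocks, lastBlocks, mem_filter, mem_filter, List.mem_toFinset, mem_take_ofFn_rev hk]
  simp only [mem_univ, true_and, Fin.coe_divNat]
  have hc : 0 < c := Nat.pos_of_ne_zero fun h => by
    subst h; exact absurd x.2 (by simp)
  rw [Nat.le_div_iff_mul_le hc]

/-- The Kazhdan–Lusztig polynomial of the Catalan matroid, as a weighted sum over partitions. -/
theorem map_klPoly_catalanMatroid {a b : ℕ} (hb : 1 ≤ b) (n : ℕ) :
    (klPoly (catalanMatroid a b n)).map (Int.castRingHom ℚ)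
      = partitionSum (fun m => (uniformKL (a + b) b m).map (Int.castRingHom ℚ)) n := by
  set x : Fin n → Finset (Fin (n * (a + b))) → ℤ := fun i => excess Fin.divNat b {i} with hx
  set l₀ : List (Fin n) := List.ofFn fun j : Fin n => j.rev with hl₀
  -- The list `l₀` starts with the last block, so its prefix of length `k` consists of the last `k`
  -- blocks, and the maximum of the prefix sums is the nullity in the Catalan matroid.
  have hcat : klPoly (catalanMatroid a b n) = setKL (rankOfNullity (nest x l₀)) ∅ univ := by
    rw [klPoly_eq_setKL _ (catalanMatroid_loopless hb) univ (by rw [coe_univ]; rfl)]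
    refine setKL_congr fun S _ => rk_catalanMatroid (by omega) (nest x l₀) (fun S k hk => ?_)
      (fun S => ?_) S
    · rw [← sum_take_ofFn_rev b hk]
      exact sum_take_le_nest x l₀ S k
    · obtain ⟨k, hk, h⟩ := exists_sum_take_eq_nest x l₀ S
      have hk' : k ≤ n := by simpa [hl₀] using hk
      exact ⟨k, hk', by rw [← h, ← sum_take_ofFn_rev b hk']⟩
  -- Spitzer's identity `h1` links the two evaluations: the sum over set partitions (`h2`, started
  -- with the zero nullity function) and the sum over orderings (`h3`). Each carries the factor
  -- `n!`, which cancels at the end.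
  have h1 := linExt_orderSum_eq (setKL_mem_chainSpan (empty_subset (univ : Finset _))) x
    (fun i => monotone_excess Fin.divNat b {i}) univ
  have h2 := linExt_cycleSum (b := b) (c := a + b) Fin.divNat card_blocks_divNat
    (univ : Finset (Fin n)) 0 ⟨rfl, fun S T hST => ⟨le_rfl, by
      have := card_le_card (inter_subset_inter_right (u := blocks Fin.divNat univᶜ) hST)
      simp only [Pi.zero_apply]; omega⟩⟩
  have h3 := map_orderSum_eq_of_forall_nest x univ
    (linExt fun f => (setKL (rankOfNullity f) ∅ univ).map (Int.castRingHom ℚ))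
    ((klPoly (catalanMatroid a b n)).map (Int.castRingHom ℚ)) (fun l hl hlu => by
      obtain ⟨σ, hσ⟩ := exists_perm_of_nodup (l' := l₀) hl nodup_ofFn_rev
        (fun i => List.mem_toFinset.1 (hlu ▸ mem_univ i))
        (fun i => (List.mem_ofFn' _ _).2 ⟨i.rev, Fin.rev_rev i⟩)
      rw [linExt_single, one_smul, hcat, hσ, setKL_nest_map])
  have hempty : blocks (Fin.divNat : Fin (n * (a + b)) → Fin n) univᶜ = ∅ := by
    ext y; simp [blocks]
  rw [hempty, setKL_self, Polynomial.map_one, mul_one, ← AddMonoidAlgebra.one_def, one_mul,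
    card_univ, Fintype.card_fin] at h2
  rw [card_univ, Fintype.card_fin] at h3
  have h4 := h3.symm.trans (h1.trans h2)
  have hn : (n ! : ℚ) ≠ 0 := by exact_mod_cast (Nat.factorial_pos n).ne'
  exact smul_right_injective _ hn h4

end Main

end CatalanKL

theorem corollary4p4 (a b n : ℕ) (ha : 1 ≤ a) (hb : 1 ≤ b) (hn : 1 ≤ n) :
    (CatalanKL.klPoly (CatalanKL.catalanMatroid a b n)).map (Int.castRingHom ℚ) =
        ∑ l : n.Partition, Polynomial.C (1 / (CatalanKL.zPart l : ℚ)) *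
          (CatalanKL.klPoly (CatalanKL.uniformSum a b l)).map (Int.castRingHom ℚ) ∧
      ∀ l : n.Partition, CatalanKL.klPoly (CatalanKL.uniformSum a b l) =
        (l.parts.map fun i => CatalanKL.klPoly (CatalanKL.uniformAB a b i)).prod := by
  refine ⟨?_, CatalanKL.klPoly_uniformSum hb a⟩
  rw [CatalanKL.map_klPoly_catalanMatroid hb, CatalanKL.partitionSum]
  refine Finset.sum_congr rfl fun l _ => ?_
  rw [CatalanKL.klPoly_uniformSum hb a, Polynomial.smul_eq_C_mul, Polynomial.map_multiset_prod,
    Multiset.map_map]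
  simp only [Function.comp_def, CatalanKL.klPoly_uniformAB hb]
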